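/- Consider the system $x_{k+1}=Ax_k+Bu_k+(A_1x_k+B_1u_k)v_k+w_k$ with $x_k\in\mathbb R^n$, $u_k\in\mathbb R^m$, where $(w_k)$ is i.i.d. with mean zero and covariance $\Sigma\succ0$, $(v_k)$ is i.i.d. real-valued with mean zero and variance $\sigma>0$, the sequences $(w_k)$ and $(v_k)$ are independent, and $x_0$ is square integrable with positive definite covariance matrix and independent of $(w_k,v_k)_{k\ge0}$; put $X_0=\mathbb E[x_0x_0^\top]$. A gain $L\in\mathbb R^{m\times n}$ (the policy $u_k=Lx_k$) is called admissible if the closed-loop system $x_{k+1}=(A+BL)x_k+(A_1+B_1L)x_kv_k+w_k$ is mean square stable, i.e. for all initial states and noises as above $\mathbb E[x_k]$ and $\mathbb E[x_kx_k^\top]$ converge to limits that do not depend on the initial state. Let $Q\succeq0$, $R\succ0$, $W=Q\oplus R$, $\alpha\in(0,1)$. Assume that an admissible gain exists, that $(A,A_1|\sqrt Q)$ is exactly detectable (if $x_{k+1}=Ax_k+A_1x_kv_k$ with deterministic $x_0$ has $\sqrt Q x_k=0$ a.s. for all $k$, then $\mathbb E\|x_k\|^2\to0$), and that the stochastic LQR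 problem has a solution, i.e. some admissible $L^*$ minimizes $J(L,x_0)=\sum_{k\ge0}\alpha^k\,\mathbb E\big[x_k^\top(Q+L^\top RL)x_k\big]$ (along the closed loop) among all admissible $L$. Let $P^*\succeq0$ solve $$P=Q+\alpha A^\top PA+\alpha\sigma A_1^\top PA_1-\alpha^2(A^\top PB+\sigma A_1^\top PB_1)(R+\alpha B^\top PB+\alpha\sigma B_1^\top PB_1)^{-1}(B^\top PA+\sigma B_1^\top PA_1)$$ and let $H^*=\begin{bmatrix}H_{11}^*&H_{12}^*\\H_{12}^{*\top}&H_{22}^*\end{bmatrix}$ with $H_{11}^*=Q+\alpha A^\top P^*A+\alpha\sigma A_1^\top P^*A_1$, $H_{12}^*=\alpha A^\top P^*B+\alpha\sigma A_1^\top P^*B_1$, $H_{22}^*=R+\alpha B^\top P^*B+\alpha\sigma B_1^\top P^*B_1$. The dual problem is to maximize $\operatorname{Tr}\big((X_0+\frac{\alpha}{1-\alpha}\Sigma)M\big)$ over symmetric $F=\begin{bmatrix}F_{11}&F_{12}\\F_{12}^\top&F_{22}\end{bmatrix}\in\mathbb R^{(n+m)\times(n+m)}$ and $M\in\mathbb R^{n\times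 n}$ subject to $F_{22}\succ0$, $\mathscr P(F)-M\succeq0$ and $\alpha[A\ B]^\top\mathscr P(F)[A\ B]-F+W+\alpha\sigma[A_1\ B_1]^\top\mathscr P(F)[A_1\ B_1]\succeq0$, where $\mathscr P(F)=F_{11}-F_{12}F_{22}^{-1}F_{12}^\top$. Then $(F,M)=(H^*,P^*)$ is an optimal point of the dual problem. Moreover, for every optimal point $(F^*,M^*)$ of the dual problem (in particular for $F^*=H^*$) there is $\varepsilon_0>0$ such that for all $0<\varepsilon\le\varepsilon_0$ and every symmetric $\hat F$ with $\|\hat F-F^*\|_F\le\varepsilon$ the block $\hat F_{22}$ is invertible and the policy $u_k=\widehat{L^*}x_k$ with $\widehat{L^*}=-\hat F_{22}^{-1}\hat F_{12}^\top$ is admissible. Consequently, if $\hat F^{(N,K)}$ are symmetric with $\|\hat F^{(N,K)}-F^*\|_F\le\varepsilon(N,K)$ and $\varepsilon(N,K)\to0$ as $N,K\to\infty$, then for all sufficiently large $N$ and $K$ the block $\hat F^{(N,K)}_{22}$ is invertible and the policy with gain $-(\hat F^{(N,K)}_{22})^{-1}(\hat F^{(N,K)}_{12})^\top$ is admissible.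 -/

import Mathlib

open MeasureTheory ProbabilityTheory Filter Topology
open scoped Matrix

universe u

namespace StochLQR

section Noise

variable {Ω : Type u} [MeasurableSpace Ω]

/-- The matrix `E[x xᵀ]` of second moments of a random vector. -/
noncomputable def secondMoment {n : ℕ} (P : Measure Ω) (x : Ω → Fin n → ℝ) :
    Matrix (Fin n) (Fin n) ℝ :=
  Matrix.of fun i j => ∫ ω, x ω i * x ω j ∂P

/-- The mean vector `E[x]` of a random vector. -/
noncomputable def meanVec {n : ℕ} (P : Measure Ω) (x : Ω → Fin n → ℝ) : Fin n → ℝ :=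
  fun i => ∫ ω, x ω i ∂P

/-- The covariance matrix of a random vector. -/
noncomputable def covMatrix {n : ℕ} (P : Measure Ω) (x : Ω → Fin n → ℝ) :
    Matrix (Fin n) (Fin n) ℝ :=
  Matrix.of fun i j => cov[fun ω => x ω i, fun ω => x ω j; P]

/-- The multiplicative noise: i.i.d. real random variables with mean zero and variance `σ`,
where `0 < σ`. -/
structure IsMultiplicativeNoise (P : Measure Ω) (v : ℕ → Ω → ℝ) (σ : ℝ) : Prop where
  measurable : ∀ k, Measurable (v k)
  memLp : ∀ k, MemLp (v k) 2 P
  indep : iIndepFun v P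
  identDistrib : ∀ k, IdentDistrib (v k) (v 0) P P
  mean_zero : ∀ k, ∫ ω, v k ω ∂P = 0
  variance_eq : ∀ k, Var[v k; P] = σ
  variance_pos : 0 < σ

/-- The additive noise: i.i.d. random vectors with mean zero and positive definite
covariance matrix `Sig`. -/
structure IsAdditiveNoise {n : ℕ} (P : Measure Ω) (w : ℕ → Ω → Fin n → ℝ)
    (Sig : Matrix (Fin n) (Fin n) ℝ) : Prop where
  measurable : ∀ k, Measurable (w k)
  memLp : ∀ k, MemLp (w k) 2 P
  indep : iIndepFun w P
  identDistrib : ∀ k, IdentDistrib (w k) (w 0) P P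
  mean_zero : ∀ k, meanVec P (w k) = 0
  cov_eq : ∀ k, covMatrix P (w k) = Sig
  cov_posDef : Sig.PosDef

/-- The standing assumptions on the initial state `x0`, the additive noise `w` (covariance `Sig`)
and the multiplicative noise `v` (variance `σ`). -/
structure NoiseAssumption {n : ℕ} (P : Measure Ω) (x0 : Ω → Fin n → ℝ)
    (w : ℕ → Ω → Fin n → ℝ) (v : ℕ → Ω → ℝ)
    (Sig : Matrix (Fin n) (Fin n) ℝ) (σ : ℝ) : Prop where
  init_measurable : Measurable x0
  init_memLp : MemLp x0 2 P
  init_cov_posDef : (covMatrix P x0).PosDef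
  init_indep : IndepFun x0 (fun ω (k : ℕ) => (w k ω, v k ω)) P
  additive : IsAdditiveNoise P w Sig
  multiplicative : IsMultiplicativeNoise P v σ
  noise_indep : IndepFun (fun ω (k : ℕ) => w k ω) (fun ω (k : ℕ) => v k ω) P

/-- The solution of `x (k+1) = A x k + (A₁ x k) v k + w k`, `x 0 = x0`. -/
def traj {n : ℕ} (A A₁ : Matrix (Fin n) (Fin n) ℝ) (x0 : Ω → Fin n → ℝ)
    (w : ℕ → Ω → Fin n → ℝ) (v : ℕ → Ω → ℝ) : ℕ → Ω → Fin n → ℝ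
  | 0 => x0
  | k + 1 => fun ω =>
      A *ᵥ traj A A₁ x0 w v k ω + v k ω • (A₁ *ᵥ traj A A₁ x0 w v k ω) + w k ω

end Noise

/-- Mean square stability of `x (k+1) = A x k + (A₁ x k) v k + w k`: for all noise sequences there
are limits of the mean and of the second moment matrix that do not depend on the initial state. -/
def MeanSquareStable {n : ℕ} (A A₁ Sig : Matrix (Fin n) (Fin n) ℝ) (σ : ℝ) : Prop :=
  ∀ (Ω : Type u) [MeasurableSpace Ω] (P : Measure Ω) [IsProbabilityMeasure P]
    (w : ℕ → Ω → Fin n → ℝ) (v : ℕ → Ω → ℝ),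
    ∃ (m : Fin n → ℝ) (X : Matrix (Fin n) (Fin n) ℝ),
      ∀ x0 : Ω → Fin n → ℝ, NoiseAssumption P x0 w v Sig σ →
        Tendsto (fun k => meanVec P (traj A A₁ x0 w v k)) atTop (𝓝 m) ∧
        Tendsto (fun k => secondMoment P (traj A A₁ x0 w v k)) atTop (𝓝 X)

/-- Exact detectability of `(A, A₁ | C)`: if the output `C x k` of
`x (k+1) = A x k + (A₁ x k) v k` vanishes almost surely at all times, then `E‖x k‖² → 0`. -/
def ExactlyDetectable {n : ℕ} (A A₁ C : Matrix (Fin n) (Fin n) ℝ) (σ : ℝ) : Prop :=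
  ∀ (Ω : Type u) [MeasurableSpace Ω] (P : Measure Ω) [IsProbabilityMeasure P]
    (v : ℕ → Ω → ℝ), IsMultiplicativeNoise P v σ → ∀ ξ : Fin n → ℝ,
      (∀ k, ∀ᵐ ω ∂P, C *ᵥ traj A A₁ (fun _ => ξ) 0 v k ω = 0) →
      Tendsto (fun k => ∫ ω, traj A A₁ (fun _ => ξ) 0 v k ω ⬝ᵥ traj A A₁ (fun _ => ξ) 0 v k ω ∂P)
        atTop (𝓝 0)

open scoped MatrixOrder in
/-- The positive semidefinite square root of a positive semidefinite matrix. -/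
noncomputable def psdSqrt {n : ℕ} (Q : Matrix (Fin n) (Fin n) ℝ) : Matrix (Fin n) (Fin n) ℝ :=
  CFC.sqrt Q

open scoped Matrix.Norms.Frobenius in
/-- The Frobenius norm. -/
noncomputable def frobNorm {ι : Type*} [Fintype ι] (M : Matrix ι ι ℝ) : ℝ := ‖M‖

/-- The coefficients of `x (k+1) = A x k + B u k + (A₁ x k + B₁ u k) v k + w k`, the noise
statistics, the weights and the discount factor of the stochastic LQR problem. -/
structure Data (n m : ℕ) where
  A : Matrix (Fin n) (Fin n) ℝ
  B : Matrix (Fin n) (Fin m) ℝ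
  A₁ : Matrix (Fin n) (Fin n) ℝ
  B₁ : Matrix (Fin n) (Fin m) ℝ
  /-- covariance matrix of the additive noise -/
  Sig : Matrix (Fin n) (Fin n) ℝ
  /-- variance of the multiplicative noise -/
  σ : ℝ
  /-- state weight -/
  Q : Matrix (Fin n) (Fin n) ℝ
  /-- input weight -/
  R : Matrix (Fin m) (Fin m) ℝ
  /-- discount factor -/
  α : ℝ
  Q_posSemidef : Q.PosSemidef
  R_posDef : R.PosDef
  α_pos : 0 < α
  α_lt_one : α < 1

namespace Data

variable {n m : ℕ} (S : Data n m)

/-- The feedback `u k = L x k` is admissible: the closed-loop system is mean square stable. -/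
def Admissible (L : Matrix (Fin m) (Fin n) ℝ) : Prop :=
  MeanSquareStable.{u} (S.A + S.B * L) (S.A₁ + S.B₁ * L) S.Sig S.σ

/-- `W = Q ⊕ R`. -/
def W : Matrix (Fin n ⊕ Fin m) (Fin n ⊕ Fin m) ℝ := Matrix.fromBlocks S.Q 0 0 S.R

/-- The discounted cost `J(L, x0) = ∑ₖ αᵏ E [xₖ; L xₖ]ᵀ W [xₖ; L xₖ]`; it is only compared on
admissible gains, where all second moments are finite and bounded in `k`. -/
noncomputable def cost {Ω : Type u} [MeasurableSpace Ω] (P : Measure Ω) (x0 : Ω → Fin n → ℝ)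
    (w : ℕ → Ω → Fin n → ℝ) (v : ℕ → Ω → ℝ) (L : Matrix (Fin m) (Fin n) ℝ) : ℝ :=
  ∑' k : ℕ, S.α ^ k * ∫ ω,
    (let x := traj (S.A + S.B * L) (S.A₁ + S.B₁ * L) x0 w v k ω
     Sum.elim x (L *ᵥ x) ⬝ᵥ S.W *ᵥ Sum.elim x (L *ᵥ x)) ∂P

/-- `L` solves the stochastic LQR problem: it is admissible and minimizes the cost among all
admissible gains. -/
def IsOptimalGain {Ω : Type u} [MeasurableSpace Ω] (P : Measure Ω) (x0 : Ω → Fin n → ℝ)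
    (w : ℕ → Ω → Fin n → ℝ) (v : ℕ → Ω → ℝ) (L : Matrix (Fin m) (Fin n) ℝ) : Prop :=
  Admissible.{u} S L ∧
    ∀ L' : Matrix (Fin m) (Fin n) ℝ, Admissible.{u} S L' →
      S.cost P x0 w v L ≤ S.cost P x0 w v L'

/-- The block `H₂₂ = R + α Bᵀ P B + α σ B₁ᵀ P B₁`. -/
def H₂₂ (P : Matrix (Fin n) (Fin n) ℝ) : Matrix (Fin m) (Fin m) ℝ :=
  S.R + S.α • (S.Bᵀ * P * S.B) + (S.α * S.σ) • (S.B₁ᵀ * P * S.B₁)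

/-- The block `H₁₂ = α Aᵀ P B + α σ A₁ᵀ P B₁`. -/
def H₁₂ (P : Matrix (Fin n) (Fin n) ℝ) : Matrix (Fin n) (Fin m) ℝ :=
  S.α • (S.Aᵀ * P * S.B) + (S.α * S.σ) • (S.A₁ᵀ * P * S.B₁)

/-- The block `H₁₁ = Q + α Aᵀ P A + α σ A₁ᵀ P A₁`. -/
def H₁₁ (P : Matrix (Fin n) (Fin n) ℝ) : Matrix (Fin n) (Fin n) ℝ :=
  S.Q + S.α • (S.Aᵀ * P * S.A) + (S.α * S.σ) • (S.A₁ᵀ * P * S.A₁)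

/-- The parameter matrix `H` of the Q-function that belongs to `P`. -/
def H (P : Matrix (Fin n) (Fin n) ℝ) : Matrix (Fin n ⊕ Fin m) (Fin n ⊕ Fin m) ℝ :=
  Matrix.fromBlocks (S.H₁₁ P) (S.H₁₂ P) (S.H₁₂ P)ᵀ (S.H₂₂ P)

/-- `P` is a positive semidefinite solution of the discrete-time generalized algebraic Riccati
equation. -/
def IsRiccatiSolution (P : Matrix (Fin n) (Fin n) ℝ) : Prop :=
  P.PosSemidef ∧
    P = S.Q + S.α • (S.Aᵀ * P * S.A) + (S.α * S.σ) • (S.A₁ᵀ * P * S.A₁)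
      - S.α ^ 2 • ((S.Aᵀ * P * S.B + S.σ • (S.A₁ᵀ * P * S.B₁)) *
          (S.R + S.α • (S.Bᵀ * P * S.B) + (S.α * S.σ) • (S.B₁ᵀ * P * S.B₁))⁻¹ *
          (S.Bᵀ * P * S.A + S.σ • (S.B₁ᵀ * P * S.A₁)))

end Data

/-- The Schur complement `F₁₁ - F₁₂ F₂₂⁻¹ F₁₂ᵀ`. -/
noncomputable def schur {n m : ℕ} (F : Matrix (Fin n ⊕ Fin m) (Fin n ⊕ Fin m) ℝ) :
    Matrix (Fin n) (Fin n) ℝ :=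
  F.toBlocks₁₁ - F.toBlocks₁₂ * F.toBlocks₂₂⁻¹ * F.toBlocks₁₂ᵀ

/-- The feedback gain `-F₂₂⁻¹ F₁₂ᵀ`. -/
noncomputable def gain {n m : ℕ} (F : Matrix (Fin n ⊕ Fin m) (Fin n ⊕ Fin m) ℝ) :
    Matrix (Fin m) (Fin n) ℝ :=
  -(F.toBlocks₂₂⁻¹ * F.toBlocks₁₂ᵀ)

namespace Data

variable {n m : ℕ} (S : Data n m)

/-- Feasible points `(F, M)` of the dual problem. -/
structure DualFeasible (F : Matrix (Fin n ⊕ Fin m) (Fin n ⊕ Fin m) ℝ)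
    (M : Matrix (Fin n) (Fin n) ℝ) : Prop where
  symm : F.IsSymm
  posDef : F.toBlocks₂₂.PosDef
  schur_ge : (schur F - M).PosSemidef
  lmi : (S.α • ((Matrix.fromCols S.A S.B)ᵀ * schur F * Matrix.fromCols S.A S.B) - F + S.W
      + (S.α * S.σ) • ((Matrix.fromCols S.A₁ S.B₁)ᵀ * schur F *
          Matrix.fromCols S.A₁ S.B₁)).PosSemidef

/-- Optimal points of the dual problem: maximize `Tr ((X₀ + α / (1 - α) Σ) M)` over all feasible
`(F, M)`, where `X₀ = E[x₀ x₀ᵀ]`. -/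
def DualOptimal (X₀ : Matrix (Fin n) (Fin n) ℝ)
    (F : Matrix (Fin n ⊕ Fin m) (Fin n ⊕ Fin m) ℝ) (M : Matrix (Fin n) (Fin n) ℝ) : Prop :=
  S.DualFeasible F M ∧
    ∀ F' M', S.DualFeasible F' M' →
      ((X₀ + (S.α / (1 - S.α)) • S.Sig) * M').trace ≤
        ((X₀ + (S.α / (1 - S.α)) • S.Sig) * M).trace

end Data

end StochLQR

/-! The second moments of the closed loop with gain `L` evolve under the positive linear map
`X ↦ (A + B L) X (A + B L)ᵀ + σ (A₁ + B₁ L) X (A₁ + B₁ L)ᵀ`, plus the constant `Σ`, so `L` is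
admissible exactly when the powers of this map tend to zero on the positive semidefinite cone, and
by a Lyapunov certificate this is an open condition on `L`.

Write `T'` for the adjoint map of the gain `L` and `C` for its stage cost. Completing the square in
the constraint of the dual problem shows `𝒫(F) ≤ C + α T' 𝒫(F)` for every feasible `F`; when `α T'`
is stable, iterating gives `𝒫(F) ≤ P`, where `P = C + α T' P` is the value of `L`. For the gain of a
Riccati solution this is its optimality in the dual problem, stability coming from detectability: an
unstable eigenvector in the cone would have zero cost, hence would be an unobserved trajectory of
the open loop.

An optimal gain `L` is the gain of a Riccati solution, namely of its own value, since otherwise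
moving slightly towards the improved gain would lower the cost. As the weight `X₀ + α / (1 - α) Σ`
is positive definite, every optimal `F` satisfies `𝒫(F) = P`, and the constraint then forces the
gain of `F` to be `L`. Gains of matrices close to `F` are thus close to an admissible gain. -/

namespace StochLQR

open Matrix
open scoped MatrixOrder

/-! ### Positive semidefinite matrices -/

section PosSemidef

variable {ι κ : Type*}

theorem isSymm_of_posSemidef {M : Matrix ι ι ℝ} (h : M.PosSemidef) : M.IsSymm :=
  isHermitian_iff_isSymm.1 h.isHermitian

section Fintype

variable [Fintype ι]

theorem posSemidef_iff_isSymm_dotProduct_mulVec {M : Matrix ι ι ℝ} :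
    M.PosSemidef ↔ M.IsSymm ∧ ∀ x, 0 ≤ x ⬝ᵥ M *ᵥ x := by
  rw [posSemidef_iff_dotProduct_mulVec, isHermitian_iff_isSymm]
  rfl

theorem posSemidef_mul_mul_transpose [Finite κ] {M : Matrix ι ι ℝ} (h : M.PosSemidef)
    (C : Matrix κ ι ℝ) : (C * M * Cᵀ).PosSemidef := by
  simpa only [conjTranspose_eq_transpose_of_trivial] using h.mul_mul_conjTranspose_same C

theorem posSemidef_transpose_mul_mul [Finite κ] {M : Matrix ι ι ℝ} (h : M.PosSemidef)
    (C : Matrix ι κ ℝ) : (Cᵀ * M * C).PosSemidef := by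
  simpa only [conjTranspose_eq_transpose_of_trivial] using h.conjTranspose_mul_mul_same C

theorem trace_mul_vecMulVec_self (M : Matrix ι ι ℝ) (x : ι → ℝ) :
    (M * vecMulVec x x).trace = x ⬝ᵥ M *ᵥ x := by
  rw [mul_vecMulVec, trace_vecMulVec, dotProduct_comm]

theorem exists_eq_sum_vecMulVec_self {Y : Matrix ι ι ℝ} (hY : Y.PosSemidef) :
    ∃ x : ι → ι → ℝ, Y = ∑ i, vecMulVec (x i) (x i) := by
  classical
  obtain ⟨C, hC⟩ := CStarAlgebra.nonneg_iff_eq_star_mul_self.1 (nonneg_iff_posSemidef.2 hY)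
  refine ⟨fun i => C i, ?_⟩
  ext j k
  simp [hC, star_eq_conjTranspose, mul_apply, Matrix.sum_apply, vecMulVec_apply]

theorem trace_mul_nonneg {M N : Matrix ι ι ℝ} (hM : M.PosSemidef) (hN : N.PosSemidef) :
    0 ≤ (M * N).trace := by
  obtain ⟨x, rfl⟩ := exists_eq_sum_vecMulVec_self hN
  simp only [Finset.mul_sum, trace_sum, trace_mul_vecMulVec_self]
  exact Finset.sum_nonneg fun i _ => (posSemidef_iff_isSymm_dotProduct_mulVec.1 hM).2 (x i)

theorem trace_mul_le_trace_mul {X M N : Matrix ι ι ℝ} (hX : X.PosSemidef) (h : M ≤ N) :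
    (X * M).trace ≤ (X * N).trace := by
  rw [← sub_nonneg, ← trace_sub, ← Matrix.mul_sub]
  exact trace_mul_nonneg hX (le_iff.1 h)

theorem trace_le_trace_of_le {M N : Matrix ι ι ℝ} (h : M ≤ N) : M.trace ≤ N.trace :=
  sub_nonneg.1 (trace_sub N M ▸ (le_iff.1 h).trace_nonneg)

theorem abs_apply_le_trace {M : Matrix ι ι ℝ} (h : M.PosSemidef) (i j : ι) :
    |M i j| ≤ M.trace := by
  classical
  have hquad := (posSemidef_iff_isSymm_dotProduct_mulVec.1 h).2
  have hsymm : M j i = M i j := (isSymm_of_posSemidef h).apply i j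
  have hdiag (i : ι) : M i i ≤ M.trace :=
    Finset.single_le_sum (f := fun i => M i i) (fun _ _ => h.diag_nonneg) (Finset.mem_univ i)
  have hadd := hquad (Pi.single i 1 + Pi.single j 1)
  have hsub := hquad (Pi.single i 1 - Pi.single j 1)
  simp only [mulVec_add, mulVec_sub, add_dotProduct, sub_dotProduct, dotProduct_add,
    dotProduct_sub, mulVec_single_one, single_dotProduct, col_apply, one_mul, hsymm] at hadd hsub
  exact abs_le.2 ⟨by linarith [hdiag i, hdiag j], by linarith [hdiag i, hdiag j]⟩

theorem tendsto_trace {α : Type*} {l : Filter α} {f : α → Matrix ι ι ℝ} {a : Matrix ι ι ℝ}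
    (h : Tendsto f l (𝓝 a)) : Tendsto (fun x => (f x).trace) l (𝓝 a.trace) :=
  ((continuous_id.matrix_trace).tendsto a).comp h

theorem tendsto_zero_of_tendsto_trace {α : Type*} {l : Filter α} {f : α → Matrix ι ι ℝ}
    (hf : ∀ x, (f x).PosSemidef) (h : Tendsto (fun x => (f x).trace) l (𝓝 0)) :
    Tendsto f l (𝓝 0) :=
  tendsto_pi_nhds.2 fun i => tendsto_pi_nhds.2 fun j =>
    squeeze_zero_norm (fun x => abs_apply_le_trace (hf x) i j) h

theorem summable_of_summable_trace {α : Type*} {f : α → Matrix ι ι ℝ}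
    (hf : ∀ x, (f x).PosSemidef) (h : Summable fun x => (f x).trace) : Summable f :=
  Pi.summable.2 fun i => Pi.summable.2 fun j =>
    h.of_norm_bounded fun x => abs_apply_le_trace (hf x) i j

end Fintype

section Finite

variable [Finite ι]

theorem isClosed_setOf_posSemidef : IsClosed {M : Matrix ι ι ℝ | M.PosSemidef} := by
  cases nonempty_fintype ι
  simp only [posSemidef_iff_isSymm_dotProduct_mulVec, Set.ofPred_and, IsSymm, Set.ofPred_forall]
  exact (isClosed_eq (by fun_prop) continuous_id).inter
    (isClosed_iInter fun x => isClosed_le continuous_const (by fun_prop))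

theorem tendsto_zero_of_le {α : Type*} {l : Filter α} {f g : α → Matrix ι ι ℝ}
    (hf : ∀ x, (f x).PosSemidef) (h : ∀ x, f x ≤ g x) (hg : Tendsto g l (𝓝 0)) :
    Tendsto f l (𝓝 0) := by
  cases nonempty_fintype ι
  exact tendsto_zero_of_tendsto_trace hf <| squeeze_zero (fun x => (hf x).trace_nonneg)
    (fun x => trace_le_trace_of_le (h x)) (trace_zero ι ℝ ▸ tendsto_trace hg)

/-- By homogeneity only unit vectors matter, and these form a compact set. -/
theorem eventually_posDef {α : Type*} {l : Filter α} {f : α → Matrix ι ι ℝ} {a : Matrix ι ι ℝ}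
    (hf : Tendsto f l (𝓝 a)) (ha : a.PosDef) (hs : ∀ᶠ x in l, (f x).IsSymm) :
    ∀ᶠ x in l, (f x).PosDef := by
  cases nonempty_fintype ι
  have hcont : Continuous fun p : Matrix ι ι ℝ × (ι → ℝ) => p.2 ⬝ᵥ p.1 *ᵥ p.2 := by fun_prop
  have hsphere : ∀ᶠ M in 𝓝 a, ∀ y ∈ Metric.sphere (0 : ι → ℝ) 1, 0 < y ⬝ᵥ M *ᵥ y := by
    refine (isCompact_sphere _ _).eventually_forall_of_forall_eventually fun y hy => ?_
    refine hcont.continuousAt.eventually (lt_mem_nhds ?_)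
    exact ha.dotProduct_mulVec_pos (ne_zero_of_mem_unit_sphere ⟨y, hy⟩)
  filter_upwards [hf.eventually hsphere, hs] with x hx hsx
  refine .of_dotProduct_mulVec_pos (isHermitian_iff_isSymm.2 hsx) fun {y} hy => ?_
  have hpos := hx (‖y‖⁻¹ • y) (by simpa using norm_smul_inv_norm (𝕜 := ℝ) hy)
  rw [mulVec_smul, smul_dotProduct, dotProduct_smul, smul_smul, smul_eq_mul] at hpos
  exact pos_of_mul_pos_right hpos (mul_self_nonneg _)

theorem exists_le_smul_of_posDef {X D : Matrix ι ι ℝ} (hX : X.IsSymm) (hD : D.PosDef) :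
    ∃ c : ℝ, 0 < c ∧ X ≤ c • D := by
  cases nonempty_fintype ι
  have hlim : Tendsto (fun t : ℝ => D - t • X) (𝓝[>] 0) (𝓝 D) := by
    have hcont : Continuous fun t : ℝ => D - t • X := by fun_prop
    simpa using (hcont.tendsto 0).mono_left nhdsWithin_le_nhds
  have hsymm (t : ℝ) : (D - t • X).IsSymm :=
    (isSymm_of_posSemidef hD.posSemidef).sub (hX.smul t)
  obtain ⟨t, hDX, ht : 0 < t⟩ :=
    ((eventually_posDef hlim hD (.of_forall hsymm)).and self_mem_nhdsWithin).exists
  refine ⟨t⁻¹, inv_pos.2 ht, ?_⟩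
  rw [le_iff]
  have hscaled := hDX.posSemidef.smul (inv_pos.2 ht).le
  rwa [smul_sub, inv_smul_smul₀ ht.ne'] at hscaled

end Finite

variable [Fintype ι]

theorem isCompact_setOf_posSemidef_trace_eq_one :
    IsCompact {M : Matrix ι ι ℝ | M.PosSemidef ∧ M.trace = 1} := by
  have hbox : IsCompact (Set.univ.pi fun _ : ι => Set.univ.pi fun _ : ι => Set.Icc (-1 : ℝ) 1) :=
    isCompact_univ_pi fun _ => isCompact_univ_pi fun _ => isCompact_Icc
  refine hbox.of_isClosed_subset
    (isClosed_setOf_posSemidef.inter (isClosed_eq (by fun_prop) continuous_const)) ?_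
  exact fun M hM i _ j _ => abs_le.1 ((abs_apply_le_trace hM.1 i j).trans_eq hM.2)

theorem eq_zero_of_trace_mul_le_zero {X D : Matrix ι ι ℝ} (hX : X.PosDef) (hD : D.PosSemidef)
    (h : (X * D).trace ≤ 0) : D = 0 := by
  classical
  obtain ⟨c, hc, hcX⟩ := exists_le_smul_of_posDef isSymm_one hX
  have htrace : 0 ≤ c * (X * D).trace - D.trace := by
    simpa [sub_mul] using trace_mul_nonneg (le_iff.1 hcX) hD
  have : D.trace ≤ 0 := by linarith [mul_nonpos_of_nonneg_of_nonpos hc.le h]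
  exact hD.trace_eq_zero_iff.1 (this.antisymm hD.trace_nonneg)

theorem mul_eq_zero_of_mul_mul_transpose_eq_zero {Y : Matrix ι ι ℝ} (hY : Y.PosSemidef)
    {C : Matrix κ ι ℝ} (h : C * Y * Cᵀ = 0) : C * Y = 0 := by
  ext i j
  have hi : star (C i) ⬝ᵥ Y *ᵥ C i = 0 := by
    rw [dotProduct_mulVec]
    exact congrFun₂ h i i
  have hrow := congrFun ((hY.dotProduct_mulVec_zero_iff (C i)).1 hi) j
  rwa [← (isSymm_of_posSemidef hY).eq, mulVec_transpose] at hrow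

end PosSemidef

theorem eq_zero_of_transpose_mul_mul_eq_zero {ι κ : Type*} [Finite ι] [Fintype κ]
    {M : Matrix κ κ ℝ} (hM : M.PosDef) {C : Matrix κ ι ℝ} (h : Cᵀ * M * C = 0) : C = 0 := by
  cases nonempty_fintype ι
  refine self_mul_conjTranspose_eq_zero.1 <|
    eq_zero_of_trace_mul_le_zero hM (posSemidef_self_mul_conjTranspose C) ?_
  rw [conjTranspose_eq_transpose_of_trivial, ← Matrix.mul_assoc, trace_mul_comm,
    ← Matrix.mul_assoc, h, trace_zero]

/-! ### Stable positive maps -/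

section PositiveMaps

variable {ι : Type*}

/-- A linear map on matrices that preserves positive semidefiniteness. -/
def PosMap (T : Matrix ι ι ℝ →ₗ[ℝ] Matrix ι ι ℝ) : Prop :=
  ∀ X, X.PosSemidef → (T X).PosSemidef

/-- The powers of `T` tend to zero on the cone of positive semidefinite matrices. -/
def PowStable (T : Matrix ι ι ℝ →ₗ[ℝ] Matrix ι ι ℝ) : Prop :=
  ∀ X : Matrix ι ι ℝ, X.PosSemidef → Tendsto (fun k => (T ^ k) X) atTop (𝓝 0)

variable {T : Matrix ι ι ℝ →ₗ[ℝ] Matrix ι ι ℝ}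

theorem PosMap.mono (hT : PosMap T) {X Y : Matrix ι ι ℝ} (h : X ≤ Y) : T X ≤ T Y := by
  rw [le_iff, ← map_sub]
  exact hT _ h

theorem PosMap.pow (hT : PosMap T) (k : ℕ) : PosMap (T ^ k) := by
  induction k with
  | zero => exact fun X hX => hX
  | succ k ih => exact fun X hX => pow_succ' T k ▸ hT _ (ih X hX)

theorem PosMap.smul (hT : PosMap T) {t : ℝ} (ht : 0 ≤ t) : PosMap (t • T) :=
  fun X hX => (hT X hX).smul ht

theorem sum_range_pow_apply_sub (T : Matrix ι ι ℝ →ₗ[ℝ] Matrix ι ι ℝ) (X : Matrix ι ι ℝ) (N : ℕ) :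
    ∑ k ∈ Finset.range N, (T ^ k) (X - T X) = X - (T ^ N) X := by
  simpa [pow_succ] using Finset.sum_range_sub' (fun k => (T ^ k) X) N

section Finite

variable [Finite ι]

theorem PosMap.summable_pow_apply (hT : PosMap T) {R X : Matrix ι ι ℝ} (hR : R.PosSemidef)
    (hX : X.PosSemidef) (h : X ≤ R - T R) : Summable fun k => (T ^ k) X := by
  cases nonempty_fintype ι
  refine summable_of_summable_trace (fun k => hT.pow k X hX) <|
    summable_of_sum_range_le (c := R.trace) (fun k => (hT.pow k X hX).trace_nonneg) fun N => ?_
  rw [← trace_sum]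
  refine trace_le_trace_of_le ?_
  calc ∑ k ∈ Finset.range N, (T ^ k) X
      ≤ ∑ k ∈ Finset.range N, (T ^ k) (R - T R) := Finset.sum_le_sum fun k _ => (hT.pow k).mono h
    _ = R - (T ^ N) R := sum_range_pow_apply_sub T R N
    _ ≤ R := sub_le_self R (nonneg_iff_posSemidef.2 (hT.pow N R hR))

theorem PowStable.of_posDef (hT : PosMap T) {D : Matrix ι ι ℝ} (hD : D.PosDef)
    (h : Tendsto (fun k => (T ^ k) D) atTop (𝓝 0)) : PowStable T := by
  intro X hX
  obtain ⟨c, -, hc⟩ := exists_le_smul_of_posDef (isSymm_of_posSemidef hX) hD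
  refine tendsto_zero_of_le (fun k => hT.pow k X hX) (fun k => (hT.pow k).mono hc) ?_
  simpa using h.const_smul c

theorem PowStable.of_lyapunov (hT : PosMap T) {R : Matrix ι ι ℝ} (hR : R.PosSemidef)
    (h : (R - T R).PosDef) : PowStable T :=
  .of_posDef hT h (hT.summable_pow_apply hR h.posSemidef le_rfl).tendsto_atTop_zero

theorem PowStable.exists_lyapunov (hT : PosMap T) (h : PowStable T) :
    ∃ R : Matrix ι ι ℝ, R.PosSemidef ∧ (R - T R).PosDef := by
  classical
  have hlim : Tendsto (fun k => 1 - (T ^ k) 1) atTop (𝓝 (1 : Matrix ι ι ℝ)) := by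
    simpa using (h 1 .one).const_sub 1
  have hsymm (k : ℕ) : (1 - (T ^ k) 1).IsSymm :=
    isSymm_one.sub (isSymm_of_posSemidef (hT.pow k 1 .one))
  obtain ⟨N, hN⟩ := (eventually_posDef hlim .one (.of_forall hsymm)).exists
  refine ⟨∑ k ∈ Finset.range N, (T ^ k) 1, posSemidef_sum _ fun k _ => hT.pow k 1 .one, ?_⟩
  have hcomm (k : ℕ) : T ((T ^ k) 1) = (T ^ k) (T 1) :=
    LinearMap.congr_fun ((pow_succ' T k).symm.trans (pow_succ T k)) 1
  rw [map_sum, ← Finset.sum_sub_distrib]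
  simpa only [hcomm, ← map_sub, sum_range_pow_apply_sub] using hN

theorem PowStable.summable (hT : PosMap T) (h : PowStable T) {X : Matrix ι ι ℝ}
    (hX : X.PosSemidef) : Summable fun k => (T ^ k) X := by
  obtain ⟨R, hR, hD⟩ := h.exists_lyapunov hT
  obtain ⟨c, hc, hXc⟩ := exists_le_smul_of_posDef (isSymm_of_posSemidef hX) hD
  exact hT.summable_pow_apply (hR.smul hc.le) hX (by rwa [map_smul, ← smul_sub])

theorem PowStable.exists_eq_add_apply (hT : PosMap T) (h : PowStable T) {C : Matrix ι ι ℝ}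
    (hC : C.PosSemidef) : ∃ X : Matrix ι ι ℝ, X.PosSemidef ∧ X = C + T X ∧
      HasSum (fun k => (T ^ k) C) X := by
  obtain ⟨X, hX⟩ := h.summable hT hC
  refine ⟨X, isClosed_setOf_posSemidef.mem_of_tendsto hX.tendsto_sum_nat
    (.of_forall fun N => posSemidef_sum _ fun k _ => hT.pow k C hC), ?_, hX⟩
  have htail : HasSum (fun k => (T ^ (k + 1)) C) (T X) := by
    simpa only [Function.comp_def, pow_succ', Module.End.mul_apply] using
      hX.map T T.continuous_of_finiteDimensional
  exact hX.unique (HasSum.zero_add (f := fun k => (T ^ k) C) htail)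

theorem PowStable.eventually (hT : PosMap T) (h : PowStable T) {α : Type*} {l : Filter α}
    {f : α → Matrix ι ι ℝ →ₗ[ℝ] Matrix ι ι ℝ} (hf : ∀ᶠ a in l, PosMap (f a))
    (hlim : ∀ X, Tendsto (fun a => f a X) l (𝓝 (T X))) : ∀ᶠ a in l, PowStable (f a) := by
  obtain ⟨R, hR, hD⟩ := h.exists_lyapunov hT
  have hsymm : ∀ᶠ a in l, (R - f a R).IsSymm := hf.mono fun a ha =>
    (isSymm_of_posSemidef hR).sub (isSymm_of_posSemidef (ha R hR))
  filter_upwards [hf, eventually_posDef ((hlim R).const_sub R) hD hsymm] with a ha hpos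
  exact .of_lyapunov ha hR hpos

theorem PowStable.smul (hT : PosMap T) (h : PowStable T) {t : ℝ} (ht₀ : 0 ≤ t) (ht₁ : t ≤ 1) :
    PowStable (t • T) := by
  obtain ⟨R, hR, hD⟩ := h.exists_lyapunov hT
  refine .of_lyapunov (hT.smul ht₀) hR ?_
  have hrest : ((1 - t) • T R).PosSemidef := (hT R hR).smul (sub_nonneg.2 ht₁)
  have hsplit : R - (t • T) R = R - T R + (1 - t) • T R := by
    rw [LinearMap.smul_apply]
    module
  exact hsplit ▸ hD.add_posSemidef hrest

theorem PowStable.posSemidef_of_apply_le (hT : PosMap T) (h : PowStable T) {D : Matrix ι ι ℝ}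
    (hD : D.IsSymm) (hle : T D ≤ D) : D.PosSemidef := by
  classical
  obtain ⟨c, -, hc⟩ := exists_le_smul_of_posDef hD.neg (.one (n := ι) (R := ℝ))
  have hiter (k : ℕ) : -D ≤ (T ^ k) (-D) := by
    induction k with
    | zero => exact le_rfl
    | succ k ih =>
      refine ih.trans ?_
      rw [pow_succ, Module.End.mul_apply, map_neg T]
      exact (hT.pow k).mono (neg_le_neg hle)
  have hlim : Tendsto (fun k => c • (T ^ k) 1 + D) atTop (𝓝 D) := by
    simpa using ((h 1 .one).const_smul c).add_const D
  refine isClosed_setOf_posSemidef.mem_of_tendsto hlim (.of_forall fun k => ?_)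
  have hbound := (hiter k).trans ((hT.pow k).mono hc)
  rwa [map_smul, le_iff, sub_neg_eq_add] at hbound

theorem PosMap.exists_critical_smul (hT : PosMap T) (h : ¬ PowStable T) :
    ∃ (s : ℝ) (t : ℕ → ℝ), s ∈ Set.Icc 0 1 ∧ Tendsto t atTop (𝓝 s) ∧
      (∀ j, 0 ≤ t j ∧ PowStable (t j • T)) ∧ ¬ PowStable (s • T) := by
  let Φ : Set ℝ := {t | t ∈ Set.Icc 0 1 ∧ PowStable (t • T)}
  have hzero : (0 : ℝ) ∈ Φ := by
    refine ⟨by simp, fun X _ => tendsto_const_nhds.congr' ?_⟩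
    filter_upwards [eventually_ne_atTop 0] with k hk
    rw [zero_smul, zero_pow hk, LinearMap.zero_apply]
  have hbdd : BddAbove Φ := ⟨1, fun t ht => ht.1.2⟩
  obtain ⟨t, -, hts, ht⟩ := exists_seq_tendsto_sSup ⟨0, hzero⟩ hbdd
  have hs₀ : 0 ≤ sSup Φ := le_csSup hbdd hzero
  have hs₁ : sSup Φ ≤ 1 := csSup_le ⟨0, hzero⟩ fun t ht => ht.1.2
  refine ⟨sSup Φ, t, ⟨hs₀, hs₁⟩, hts, fun j => ⟨(ht j).1.1, (ht j).2⟩, fun hstable => ?_⟩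
  have hlt : sSup Φ < 1 := hs₁.lt_of_ne fun heq => h (by rwa [heq, one_smul] at hstable)
  have hpos : ∀ᶠ t in 𝓝[>] sSup Φ, PosMap (t • T) :=
    eventually_mem_nhdsWithin.mono fun t ht => hT.smul (hs₀.trans (le_of_lt ht))
  have hlim (X : Matrix ι ι ℝ) : Tendsto (fun t => (t • T) X) (𝓝[>] sSup Φ) (𝓝 ((sSup Φ • T) X)) :=
    (tendsto_id.smul_const (T X)).mono_left nhdsWithin_le_nhds
  obtain ⟨t, ht, htΦ⟩ := ((hstable.eventually (hT.smul hs₀) hpos hlim).and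
    (Ioo_mem_nhdsGT hlt)).exists
  exact (le_csSup hbdd ⟨⟨hs₀.trans htΦ.1.le, htΦ.2.le⟩, ht⟩).not_gt htΦ.1

end Finite

variable [Fintype ι]

theorem PowStable.adjoint {T' : Matrix ι ι ℝ →ₗ[ℝ] Matrix ι ι ℝ} (hT' : PosMap T')
    (hadj : ∀ X Y, (T' X * Y).trace = (X * T Y).trace) (h : PowStable T) : PowStable T' := by
  classical
  have hpow (k : ℕ) (X Y : Matrix ι ι ℝ) : ((T' ^ k) X * Y).trace = (X * (T ^ k) Y).trace := by
    induction k generalizing X Y with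
    | zero => rfl
    | succ k ih => rw [pow_succ', pow_succ, Module.End.mul_apply, Module.End.mul_apply, hadj, ih]
  intro X hX
  refine tendsto_zero_of_tendsto_trace (fun k => hT'.pow k X hX) ?_
  have hpair (k : ℕ) : ((T' ^ k) X).trace = (X * (T ^ k) 1).trace := by
    rw [← hpow, Matrix.mul_one]
  simpa only [hpair, Matrix.mul_zero, trace_zero] using tendsto_trace ((h 1 .one).const_mul X)

/-- The solutions of `R = 1 + t j • T R`, scaled to trace one, accumulate at the eigenvector. -/
theorem PosMap.exists_smul_apply_eq_of_tendsto (hT : PosMap T) {t : ℕ → ℝ} {s : ℝ}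
    (hts : Tendsto t atTop (𝓝 s)) (ht : ∀ j, 0 ≤ t j) (hstable : ∀ j, PowStable (t j • T))
    (hs : ¬ PowStable (s • T)) : ∃ Z : Matrix ι ι ℝ, Z.PosSemidef ∧ Z.trace = 1 ∧ s • T Z = Z := by
  classical
  have : FirstCountableTopology (Matrix ι ι ℝ) :=
    inferInstanceAs (FirstCountableTopology (ι → ι → ℝ))
  have : Nonempty ι := not_isEmpty_iff.1 fun _ => hs fun X _ => by
    simpa only [Subsingleton.elim _ (0 : Matrix ι ι ℝ)] using tendsto_const_nhds
  choose R hR hfix _ using fun j => (hstable j).exists_eq_add_apply (hT.smul (ht j)) .one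
  have htrace (j : ℕ) : 1 ≤ (R j).trace := by
    rw [hfix j, trace_add, trace_one]
    exact le_add_of_le_of_nonneg (mod_cast Fintype.card_pos)
      (hT.smul (ht j) _ (hR j)).trace_nonneg
  let b (j : ℕ) : ℝ := (R j).trace⁻¹
  have hb (j : ℕ) : b j ∈ Set.Icc (0 : ℝ) 1 :=
    ⟨inv_nonneg.2 (zero_le_one.trans (htrace j)), inv_le_one_of_one_le₀ (htrace j)⟩
  have hmem (j : ℕ) : b j • R j ∈ {M : Matrix ι ι ℝ | M.PosSemidef ∧ M.trace = 1} :=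
    ⟨(hR j).smul (hb j).1, by
      rw [trace_smul, smul_eq_mul, inv_mul_cancel₀ (zero_lt_one.trans_le (htrace j)).ne']⟩
  have hres (j : ℕ) : b j • R j - t j • T (b j • R j) = b j • (1 : Matrix ι ι ℝ) := by
    rw [map_smul, smul_comm, ← smul_sub]
    exact congrArg _ (sub_eq_of_eq_add (hfix j))
  obtain ⟨⟨Z, β⟩, ⟨⟨hZ, hZ₁⟩, hβ⟩, φ, hφ, hlim⟩ :=
    (isCompact_setOf_posSemidef_trace_eq_one.prod isCompact_Icc).tendsto_subseq
      (x := fun j => (b j • R j, b j)) fun j => ⟨hmem j, hb j⟩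
  have hZlim := (continuous_fst.tendsto _).comp hlim
  have hreslim := hZlim.sub ((hts.comp hφ.tendsto_atTop).smul
    ((T.continuous_of_finiteDimensional.tendsto Z).comp hZlim))
  have hZeq : Z - s • T Z = β • (1 : Matrix ι ι ℝ) := by
    refine tendsto_nhds_unique hreslim ?_
    simpa only [Function.comp_def, hres] using
      (((continuous_snd.tendsto _).comp hlim).smul_const (1 : Matrix ι ι ℝ))
  have hβ₀ : β = 0 := by
    by_contra hne
    refine hs (.of_lyapunov (hT.smul (ge_of_tendsto' hts ht)) hZ ?_)
    rw [LinearMap.smul_apply, hZeq]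
    exact PosDef.one.smul (hβ.1.lt_of_ne' hne)
  exact ⟨Z, hZ, hZ₁, (sub_eq_zero.1 (hZeq.trans (by rw [hβ₀, zero_smul]))).symm⟩

/-- A one-sided form of the Krein–Rutman theorem. -/
theorem PosMap.exists_eigenvector (hT : PosMap T) (h : ¬ PowStable T) :
    ∃ (r : ℝ) (Y : Matrix ι ι ℝ), 1 ≤ r ∧ Y.PosSemidef ∧ Y.trace = 1 ∧ T Y = r • Y := by
  obtain ⟨s, t, ⟨hs₀, hs₁⟩, hts, ht, hs⟩ := hT.exists_critical_smul h
  obtain ⟨Z, hZ, hZ₁, hsZ⟩ :=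
    hT.exists_smul_apply_eq_of_tendsto hts (fun j => (ht j).1) (fun j => (ht j).2) hs
  have hs_ne : s ≠ 0 := by
    rintro rfl
    have hZ_zero : Z = 0 := hsZ.symm.trans (zero_smul ℝ _)
    simp [hZ_zero] at hZ₁
  refine ⟨s⁻¹, Z, (one_le_inv₀ (hs₀.lt_of_ne' hs_ne)).2 hs₁, hZ, hZ₁, ?_⟩
  rw [← inv_smul_smul₀ hs_ne (T Z), hsZ]

end PositiveMaps

/-! ### Lyapunov maps and Schur complements -/

section LyapunovMap

variable {ι κ : Type*} [Fintype ι]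

/-- The evolution `X ↦ A X Aᵀ + σ A₁ X A₁ᵀ` of the second moments of
`x (k+1) = A x k + (A₁ x k) v k`, where `σ` is the variance of `v k`. -/
def lyapMap (A A₁ : Matrix ι ι ℝ) (σ : ℝ) : Matrix ι ι ℝ →ₗ[ℝ] Matrix ι ι ℝ where
  toFun X := A * X * Aᵀ + σ • (A₁ * X * A₁ᵀ)
  map_add' X Y := by
    simp only [Matrix.mul_add, Matrix.add_mul, smul_add]
    abel
  map_smul' c X := by
    simp only [Matrix.mul_smul, Matrix.smul_mul, RingHom.id_apply, smul_add, smul_comm c σ]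

theorem lyapMap_apply (A A₁ : Matrix ι ι ℝ) (σ : ℝ) (X : Matrix ι ι ℝ) :
    lyapMap A A₁ σ X = A * X * Aᵀ + σ • (A₁ * X * A₁ᵀ) := rfl

theorem posMap_lyapMap (A A₁ : Matrix ι ι ℝ) {σ : ℝ} (hσ : 0 ≤ σ) : PosMap (lyapMap A A₁ σ) :=
  fun _ hX => (posSemidef_mul_mul_transpose hX A).add
    ((posSemidef_mul_mul_transpose hX A₁).smul hσ)

theorem trace_lyapMap_transpose_mul (A A₁ : Matrix ι ι ℝ) (σ : ℝ) (X Y : Matrix ι ι ℝ) :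
    (lyapMap Aᵀ A₁ᵀ σ X * Y).trace = (X * lyapMap A A₁ σ Y).trace := by
  have hcycle (C : Matrix ι ι ℝ) : (Cᵀ * X * C * Y).trace = (X * (C * Y * Cᵀ)).trace := by
    rw [Matrix.mul_assoc Cᵀ, Matrix.mul_assoc Cᵀ, trace_mul_comm]
    simp only [Matrix.mul_assoc]
  simp only [lyapMap_apply, transpose_transpose, Matrix.add_mul, Matrix.mul_add, trace_add,
    Matrix.smul_mul, Matrix.mul_smul, trace_smul, hcycle]

variable [DecidableEq ι] [Fintype κ]

/-- The matrix `[I; L]ᵀ F [I; L]` of the quadratic form `F` restricted to the graph of `L`. -/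
def restrictGraph (L : Matrix κ ι ℝ) :
    Matrix (ι ⊕ κ) (ι ⊕ κ) ℝ →ₗ[ℝ] Matrix ι ι ℝ where
  toFun F := (fromRows (1 : Matrix ι ι ℝ) L)ᵀ * F * fromRows (1 : Matrix ι ι ℝ) L
  map_add' F G := by rw [Matrix.mul_add, Matrix.add_mul]
  map_smul' c F := by rw [Matrix.mul_smul, Matrix.smul_mul, RingHom.id_apply]

theorem restrictGraph_apply (L : Matrix κ ι ℝ) (F : Matrix (ι ⊕ κ) (ι ⊕ κ) ℝ) :
    restrictGraph L F = (fromRows (1 : Matrix ι ι ℝ) L)ᵀ * F * fromRows (1 : Matrix ι ι ℝ) L := rfl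

theorem restrictGraph_fromBlocks (L : Matrix κ ι ℝ) (F₁₁ : Matrix ι ι ℝ) (F₁₂ : Matrix ι κ ℝ)
    (F₂₁ : Matrix κ ι ℝ) (F₂₂ : Matrix κ κ ℝ) :
    restrictGraph L (fromBlocks F₁₁ F₁₂ F₂₁ F₂₂) =
      F₁₁ + F₁₂ * L + Lᵀ * F₂₁ + Lᵀ * F₂₂ * L := by
  rw [restrictGraph_apply, transpose_fromRows, Matrix.mul_assoc, fromBlocks_mul_fromRows,
    fromCols_mul_fromRows]
  simp only [transpose_one, Matrix.one_mul, Matrix.mul_one, Matrix.mul_add, Matrix.mul_assoc]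
  abel

theorem restrictGraph_transpose_mul_mul (L : Matrix κ ι ℝ) (P A : Matrix ι ι ℝ)
    (B : Matrix ι κ ℝ) :
    restrictGraph L ((fromCols A B)ᵀ * P * fromCols A B) = (A + B * L)ᵀ * P * (A + B * L) := by
  have hgraph : fromCols A B * fromRows (1 : Matrix ι ι ℝ) L = A + B * L := by
    rw [fromCols_mul_fromRows, Matrix.mul_one]
  rw [restrictGraph_apply, ← hgraph, transpose_mul]
  simp only [Matrix.mul_assoc]

theorem restrictGraph_mono {F G : Matrix (ι ⊕ κ) (ι ⊕ κ) ℝ} (h : F ≤ G) (L : Matrix κ ι ℝ) :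
    restrictGraph L F ≤ restrictGraph L G := by
  rw [le_iff, ← map_sub]
  exact posSemidef_transpose_mul_mul (le_iff.1 h) (fromRows (1 : Matrix ι ι ℝ) L)

end LyapunovMap

section Schur

variable {n m : ℕ} {F : Matrix (Fin n ⊕ Fin m) (Fin n ⊕ Fin m) ℝ}

theorem isSymm_toBlocks {ι κ : Type*} {F : Matrix (ι ⊕ κ) (ι ⊕ κ) ℝ} (hF : F.IsSymm) :
    F.toBlocks₁₁.IsSymm ∧ F.toBlocks₁₂ᵀ = F.toBlocks₂₁ ∧ F.toBlocks₂₂.IsSymm := by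
  rw [← fromBlocks_toBlocks F, isSymm_fromBlocks_iff] at hF
  exact ⟨hF.1, hF.2.1, hF.2.2.2⟩

theorem isSymm_schur (hF : F.IsSymm) : (schur F).IsSymm := by
  obtain ⟨h₁₁, -, h₂₂⟩ := isSymm_toBlocks hF
  refine h₁₁.sub ?_
  simp only [IsSymm, transpose_mul, transpose_transpose, h₂₂.inv.eq, Matrix.mul_assoc]

/-- Completing the square. -/
theorem restrictGraph_eq_schur_add (hF : F.IsSymm) (hunit : IsUnit F.toBlocks₂₂)
    (L : Matrix (Fin m) (Fin n) ℝ) :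
    restrictGraph L F = schur F + (L - gain F)ᵀ * F.toBlocks₂₂ * (L - gain F) := by
  obtain ⟨-, h₁₂, h₂₂⟩ := isSymm_toBlocks hF
  have hdet : IsUnit F.toBlocks₂₂.det := (isUnit_iff_isUnit_det _).1 hunit
  have hright : F.toBlocks₂₂ * (L - gain F) = F.toBlocks₂₂ * L + F.toBlocks₁₂ᵀ := by
    rw [gain, sub_neg_eq_add, Matrix.mul_add, mul_nonsing_inv_cancel_left _ _ hdet]
  have hleft : (L - gain F)ᵀ = Lᵀ + F.toBlocks₁₂ * F.toBlocks₂₂⁻¹ := by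
    rw [gain, sub_neg_eq_add, transpose_add, transpose_mul, transpose_transpose, h₂₂.inv.eq]
  have hcross : F.toBlocks₁₂ * F.toBlocks₂₂⁻¹ * (F.toBlocks₂₂ * L) = F.toBlocks₁₂ * L := by
    rw [Matrix.mul_assoc, nonsing_inv_mul_cancel_left _ _ hdet]
  conv_lhs => rw [← fromBlocks_toBlocks F, ← h₁₂]
  rw [restrictGraph_fromBlocks, Matrix.mul_assoc (L - gain F)ᵀ, hright, hleft, schur,
    Matrix.add_mul, Matrix.mul_add, Matrix.mul_add, hcross]
  simp only [Matrix.mul_assoc]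
  abel

theorem schur_le_restrictGraph (hF : F.IsSymm) (h : F.toBlocks₂₂.PosDef)
    (L : Matrix (Fin m) (Fin n) ℝ) : schur F ≤ restrictGraph L F := by
  rw [restrictGraph_eq_schur_add hF h.isUnit, le_iff, add_sub_cancel_left]
  exact posSemidef_transpose_mul_mul h.posSemidef _

theorem restrictGraph_gain (hF : F.IsSymm) (h : F.toBlocks₂₂.PosDef) :
    restrictGraph (gain F) F = schur F := by
  rw [restrictGraph_eq_schur_add hF h.isUnit, sub_self, Matrix.mul_zero, add_zero]

end Schur

namespace Data

variable {n m : ℕ} (S : Data n m)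

/-- The second moment evolution of the closed loop with gain `L`. -/
def closedLoop (L : Matrix (Fin m) (Fin n) ℝ) :
    Matrix (Fin n) (Fin n) ℝ →ₗ[ℝ] Matrix (Fin n) (Fin n) ℝ :=
  lyapMap (S.A + S.B * L) (S.A₁ + S.B₁ * L) S.σ

/-- The adjoint of `closedLoop` for the trace pairing, which propagates value matrices. -/
def closedLoopAdj (L : Matrix (Fin m) (Fin n) ℝ) :
    Matrix (Fin n) (Fin n) ℝ →ₗ[ℝ] Matrix (Fin n) (Fin n) ℝ :=
  lyapMap (S.A + S.B * L)ᵀ (S.A₁ + S.B₁ * L)ᵀ S.σ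

/-- The matrix of the running cost under the feedback `L`. -/
def stageCost (L : Matrix (Fin m) (Fin n) ℝ) : Matrix (Fin n) (Fin n) ℝ :=
  S.Q + Lᵀ * S.R * L

/-- The matrix of the Q-function when the value of the next state is the quadratic form `P`. -/
def bellman (P : Matrix (Fin n) (Fin n) ℝ) : Matrix (Fin n ⊕ Fin m) (Fin n ⊕ Fin m) ℝ :=
  S.α • ((fromCols S.A S.B)ᵀ * P * fromCols S.A S.B) + S.W
    + (S.α * S.σ) • ((fromCols S.A₁ S.B₁)ᵀ * P * fromCols S.A₁ S.B₁)

theorem posSemidef_stageCost (L : Matrix (Fin m) (Fin n) ℝ) : (S.stageCost L).PosSemidef :=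
  S.Q_posSemidef.add (posSemidef_transpose_mul_mul S.R_posDef.posSemidef L)

theorem trace_closedLoopAdj_mul (L : Matrix (Fin m) (Fin n) ℝ) (X Y : Matrix (Fin n) (Fin n) ℝ) :
    (S.closedLoopAdj L X * Y).trace = (X * S.closedLoop L Y).trace :=
  trace_lyapMap_transpose_mul _ _ _ _ _

theorem restrictGraph_W (L : Matrix (Fin m) (Fin n) ℝ) : restrictGraph L S.W = S.stageCost L := by
  simp [W, restrictGraph_fromBlocks, stageCost]

theorem restrictGraph_bellman (L : Matrix (Fin m) (Fin n) ℝ) (P : Matrix (Fin n) (Fin n) ℝ) :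
    restrictGraph L (S.bellman P) = S.stageCost L + S.α • S.closedLoopAdj L P := by
  simp only [bellman, map_add, map_smul, restrictGraph_W, restrictGraph_transpose_mul_mul,
    closedLoopAdj, lyapMap_apply, transpose_transpose, smul_add, smul_smul]
  abel

theorem H_eq_bellman {P : Matrix (Fin n) (Fin n) ℝ} (hP : P.IsSymm) : S.H P = S.bellman P := by
  have hblocks (A : Matrix (Fin n) (Fin n) ℝ) (B : Matrix (Fin n) (Fin m) ℝ) :
      (fromCols A B)ᵀ * P * fromCols A B =
        fromBlocks (Aᵀ * P * A) (Aᵀ * P * B) (Aᵀ * P * B)ᵀ (Bᵀ * P * B) := by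
    rw [transpose_fromCols, fromRows_mul, fromRows_mul_fromCols]
    simp only [transpose_mul, transpose_transpose, hP.eq, Matrix.mul_assoc]
  rw [H, bellman, hblocks, hblocks, W, fromBlocks_smul, fromBlocks_smul, fromBlocks_add,
    fromBlocks_add, H₁₁, H₁₂, H₂₂, add_zero, add_zero, transpose_add, transpose_smul,
    transpose_smul, add_comm S.Q, add_comm S.R]

theorem restrictGraph_H (L : Matrix (Fin m) (Fin n) ℝ) {P : Matrix (Fin n) (Fin n) ℝ}
    (hP : P.IsSymm) : restrictGraph L (S.H P) = S.stageCost L + S.α • S.closedLoopAdj L P := by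
  rw [S.H_eq_bellman hP, restrictGraph_bellman]

variable {S}

theorem posMap_closedLoop (hσ : 0 ≤ S.σ) (L : Matrix (Fin m) (Fin n) ℝ) :
    PosMap (S.closedLoop L) :=
  posMap_lyapMap _ _ hσ

theorem posMap_closedLoopAdj (hσ : 0 ≤ S.σ) (L : Matrix (Fin m) (Fin n) ℝ) :
    PosMap (S.closedLoopAdj L) :=
  posMap_lyapMap _ _ hσ

theorem isSymm_H {P : Matrix (Fin n) (Fin n) ℝ} (hP : P.PosSemidef) : (S.H P).IsSymm := by
  have hconj {k : ℕ} (C : Matrix (Fin n) (Fin k) ℝ) : (Cᵀ * P * C).IsSymm :=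
    isSymm_of_posSemidef (posSemidef_transpose_mul_mul hP C)
  refine IsSymm.fromBlocks ?_ rfl ?_
  · exact ((isSymm_of_posSemidef S.Q_posSemidef).add ((hconj _).smul _)).add ((hconj _).smul _)
  · exact ((isSymm_of_posSemidef S.R_posDef.posSemidef).add ((hconj _).smul _)).add
      ((hconj _).smul _)

theorem posDef_toBlocks₂₂_H (hσ : 0 ≤ S.σ) {P : Matrix (Fin n) (Fin n) ℝ} (hP : P.PosSemidef) :
    (S.H P).toBlocks₂₂.PosDef := by
  rw [H, toBlocks_fromBlocks₂₂]
  exact (S.R_posDef.add_posSemidef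
    ((posSemidef_transpose_mul_mul hP S.B).smul S.α_pos.le)).add_posSemidef
    ((posSemidef_transpose_mul_mul hP S.B₁).smul (mul_nonneg S.α_pos.le hσ))

theorem isRiccatiSolution_iff {P : Matrix (Fin n) (Fin n) ℝ} :
    S.IsRiccatiSolution P ↔ P.PosSemidef ∧ P = schur (S.H P) := by
  refine and_congr_right fun hP => ?_
  have h₁₂ : S.H₁₂ P = S.α • (S.Aᵀ * P * S.B + S.σ • (S.A₁ᵀ * P * S.B₁)) := by
    rw [H₁₂, smul_add, smul_smul]
  have h₂₁ : (S.H₁₂ P)ᵀ = S.α • (S.Bᵀ * P * S.A + S.σ • (S.B₁ᵀ * P * S.A₁)) := by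
    rw [h₁₂]
    simp only [transpose_smul, transpose_add, transpose_mul, transpose_transpose,
      (isSymm_of_posSemidef hP).eq, Matrix.mul_assoc]
  have hschur : schur (S.H P) = S.H₁₁ P - S.H₁₂ P * (S.H₂₂ P)⁻¹ * (S.H₁₂ P)ᵀ := by
    simp only [schur, H, toBlocks_fromBlocks₁₁, toBlocks_fromBlocks₁₂, toBlocks_fromBlocks₂₂]
  rw [hschur, h₂₁, h₁₂, H₁₁, H₂₂, Matrix.smul_mul, Matrix.smul_mul, Matrix.mul_smul, smul_smul,
    ← sq]

theorem lmi_posSemidef_iff {F : Matrix (Fin n ⊕ Fin m) (Fin n ⊕ Fin m) ℝ}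
    {P : Matrix (Fin n) (Fin n) ℝ} :
    (S.α • ((fromCols S.A S.B)ᵀ * P * fromCols S.A S.B) - F + S.W
      + (S.α * S.σ) • ((fromCols S.A₁ S.B₁)ᵀ * P * fromCols S.A₁ S.B₁)).PosSemidef
      ↔ F ≤ S.bellman P := by
  rw [le_iff, bellman, sub_add_eq_add_sub, sub_add_eq_add_sub]

theorem IsRiccatiSolution.dualFeasible (hσ : 0 ≤ S.σ) {P : Matrix (Fin n) (Fin n) ℝ}
    (h : S.IsRiccatiSolution P) : S.DualFeasible (S.H P) P := by
  obtain ⟨hP, heq⟩ := isRiccatiSolution_iff.1 h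
  refine ⟨isSymm_H hP, posDef_toBlocks₂₂_H hσ hP, ?_, ?_⟩
  · rw [← heq, sub_self]
    exact .zero
  · rw [lmi_posSemidef_iff, ← heq, S.H_eq_bellman (isSymm_of_posSemidef hP)]

end Data

/-! ### Independence -/

section Independence

variable {Ω : Type*} [MeasurableSpace Ω] {P : Measure Ω}

theorem indepFun_of_measurable_comap {α β γ : Type*} [MeasurableSpace α] [MeasurableSpace β]
    [MeasurableSpace γ] {a : Ω → α} {b : Ω → β} {c : Ω → γ} (h : IndepFun a b P)
    (hc : Measurable[MeasurableSpace.comap a inferInstance] c) : IndepFun c b P :=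
  (IndepFun_iff_Indep _ _ _).2
    (indep_of_indep_of_le_left ((IndepFun_iff_Indep _ _ _).1 h) hc.comap_le)

theorem indepFun_prodMk_left [IsProbabilityMeasure P] {α β γ : Type*} [MeasurableSpace α]
    [MeasurableSpace β] [MeasurableSpace γ] {a : Ω → α} {b : Ω → β} {c : Ω → γ}
    (ha : Measurable a) (hb : Measurable b) (hc : Measurable c)
    (h : IndepFun a (fun ω => (b ω, c ω)) P) (hbc : IndepFun b c P) :
    IndepFun (fun ω => (a ω, b ω)) c P := by
  rw [IndepFun_iff_Indep]
  refine IndepSets.indep (ha.prodMk hb).comap_le hc.comap_le (isPiSystem_prod.comap _)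
    (@MeasurableSpace.isPiSystem_measurableSet Ω (MeasurableSpace.comap c inferInstance))
    ((congrArg _ generateFrom_prod.symm).trans MeasurableSpace.comap_generateFrom)
    (@MeasurableSpace.generateFrom_measurableSet Ω (MeasurableSpace.comap c inferInstance)).symm ?_
  rw [IndepSets_iff]
  rintro _ _ ⟨_, ⟨s, hs, t, ht, rfl⟩, rfl⟩ ⟨u, hu, rfl⟩
  have hab := (h.comp measurable_id measurable_fst).measure_inter_preimage_eq_mul s t hs ht
  have habc := h.measure_inter_preimage_eq_mul s (t ×ˢ u) hs (ht.prod hu)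
  have hbc' := hbc.measure_inter_preimage_eq_mul t u ht hu
  simp only [Function.comp_def, Set.mk_preimage_prod, id] at hab habc ⊢
  rw [Set.inter_assoc, habc, hbc', hab, mul_assoc]

theorem indepFun_past {E : Type*} [MeasurableSpace E] {f : ℕ → Ω → E}
    (hf : iIndepFun f P) (hm : ∀ k, Measurable (f k)) (k : ℕ) :
    IndepFun (fun ω (i : Finset.range k) => f i ω) (f k) P :=
  (hf.indepFun_finset (Finset.range k) {k} (by simp) hm).comp measurable_id
    (measurable_pi_apply (⟨k, Finset.mem_singleton_self k⟩ : ({k} : Finset ℕ)))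

end Independence

/-! ### Second moments -/

section Moments

variable {Ω ι κ μ ν : Type*} [MeasurableSpace Ω] {P : Measure Ω} {n : ℕ}

/-- The matrix `E[x yᵀ]` of two random vectors. -/
noncomputable def crossMoment (P : Measure Ω) (x : Ω → ι → ℝ) (y : Ω → κ → ℝ) : Matrix ι κ ℝ :=
  of fun i j => ∫ ω, x ω i * y ω j ∂P

theorem secondMoment_eq_crossMoment (x : Ω → Fin n → ℝ) : secondMoment P x = crossMoment P x x :=
  rfl

theorem transpose_crossMoment (x : Ω → ι → ℝ) (y : Ω → κ → ℝ) :
    (crossMoment P x y)ᵀ = crossMoment P y x := by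
  ext i j
  simp only [transpose_apply, crossMoment, of_apply, mul_comm]

theorem crossMoment_eq_zero_of_indepFun {x : Ω → ι → ℝ} {y : Ω → κ → ℝ}
    (hx : AEStronglyMeasurable x P) (hy : AEStronglyMeasurable y P) (h : IndepFun x y P)
    (hy₀ : ∀ j, ∫ ω, y ω j ∂P = 0) : crossMoment P x y = 0 := by
  ext i j
  have hij : IndepFun (fun ω => x ω i) (fun ω => y ω j) P :=
    h.comp (measurable_pi_apply i) (measurable_pi_apply j)
  rw [crossMoment, of_apply, hij.integral_fun_mul_eq_mul_integral
    ((continuous_apply i).comp_aestronglyMeasurable hx)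
    ((continuous_apply j).comp_aestronglyMeasurable hy), hy₀, mul_zero, Matrix.zero_apply]

section Fintype

variable [Fintype ι] [Fintype κ] {x : Ω → ι → ℝ} {y : Ω → κ → ℝ}

theorem integrable_mul_apply (hx : MemLp x 2 P) (hy : MemLp y 2 P) (i : ι) (j : κ) :
    Integrable (fun ω => x ω i * y ω j) P :=
  (hx.eval i).integrable_mul (hy.eval j)

theorem memLp_mulVec [Fintype μ] (hx : MemLp x 2 P) (C : Matrix μ ι ℝ) :
    MemLp (fun ω => C *ᵥ x ω) 2 P := by
  refine memLp_pi_iff.2 fun i => ?_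
  simp only [mulVec, dotProduct]
  exact memLp_finsetSum _ fun j _ => (hx.eval j).const_mul _

theorem crossMoment_mulVec_left (hx : MemLp x 2 P) (hy : MemLp y 2 P) (C : Matrix μ ι ℝ) :
    crossMoment P (fun ω => C *ᵥ x ω) y = C * crossMoment P x y := by
  ext i j
  simp only [crossMoment, of_apply, mulVec, dotProduct, mul_apply, Finset.sum_mul, mul_assoc]
  rw [integral_finsetSum _ fun l _ => (integrable_mul_apply hx hy l j).const_mul _]
  simp only [integral_const_mul]

theorem crossMoment_add_left {x' : Ω → ι → ℝ} (hx : MemLp x 2 P) (hx' : MemLp x' 2 P)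
    (hy : MemLp y 2 P) : crossMoment P (x + x') y = crossMoment P x y + crossMoment P x' y := by
  ext i j
  simp only [crossMoment, of_apply, Matrix.add_apply, Pi.add_apply, add_mul]
  exact integral_add (integrable_mul_apply hx hy i j) (integrable_mul_apply hx' hy i j)

theorem crossMoment_add_right {y' : Ω → κ → ℝ} (hx : MemLp x 2 P) (hy : MemLp y 2 P)
    (hy' : MemLp y' 2 P) : crossMoment P x (y + y') = crossMoment P x y + crossMoment P x y' := by
  rw [← transpose_crossMoment, crossMoment_add_left hy hy' hx, transpose_add,
    transpose_crossMoment, transpose_crossMoment]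

theorem crossMoment_mulVec_mulVec [Finite μ] [Finite ν] (hx : MemLp x 2 P) (hy : MemLp y 2 P)
    (C : Matrix μ ι ℝ) (D : Matrix ν κ ℝ) :
    crossMoment P (fun ω => C *ᵥ x ω) (fun ω => D *ᵥ y ω) = C * crossMoment P x y * Dᵀ := by
  cases nonempty_fintype μ
  cases nonempty_fintype ν
  rw [crossMoment_mulVec_left hx (memLp_mulVec hy D), ← transpose_crossMoment,
    crossMoment_mulVec_left hy hx, transpose_mul, transpose_crossMoment, Matrix.mul_assoc]

theorem integrable_dotProduct {y : Ω → ι → ℝ} (hx : MemLp x 2 P) (hy : MemLp y 2 P) :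
    Integrable (fun ω => x ω ⬝ᵥ y ω) P :=
  integrable_finsetSum _ fun i _ => integrable_mul_apply hx hy i i

theorem integral_dotProduct {y : Ω → ι → ℝ} (hx : MemLp x 2 P) (hy : MemLp y 2 P) :
    ∫ ω, x ω ⬝ᵥ y ω ∂P = (crossMoment P x y).trace :=
  integral_finsetSum _ fun i _ => integrable_mul_apply hx hy i i

end Fintype

variable {x y : Ω → Fin n → ℝ} {v : Ω → ℝ}

theorem integral_dotProduct_mulVec (hx : MemLp x 2 P) (C : Matrix (Fin n) (Fin n) ℝ) :
    ∫ ω, x ω ⬝ᵥ C *ᵥ x ω ∂P = (C * secondMoment P x).trace := by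
  rw [integral_dotProduct hx (memLp_mulVec hx C), ← trace_transpose, transpose_crossMoment,
    crossMoment_mulVec_left hx hx, secondMoment_eq_crossMoment]

theorem posSemidef_secondMoment (hx : MemLp x 2 P) : (secondMoment P x).PosSemidef := by
  refine posSemidef_iff_isSymm_dotProduct_mulVec.2 ⟨transpose_crossMoment x x, fun y => ?_⟩
  rw [← trace_mul_vecMulVec_self, trace_mul_comm, ← integral_dotProduct_mulVec hx]
  exact integral_nonneg fun ω =>
    (posSemidef_iff_isSymm_dotProduct_mulVec.1 (posSemidef_vecMulVec_self_star y)).2 _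

theorem secondMoment_add (hx : MemLp x 2 P) (hy : MemLp y 2 P) (h : crossMoment P x y = 0) :
    secondMoment P (x + y) = secondMoment P x + secondMoment P y := by
  have h' : crossMoment P y x = 0 := by rw [← transpose_crossMoment, h, transpose_zero]
  rw [secondMoment_eq_crossMoment, crossMoment_add_left hx hy (hx.add hy),
    crossMoment_add_right hx hx hy, crossMoment_add_right hy hx hy, h, h', add_zero, zero_add,
    secondMoment_eq_crossMoment, secondMoment_eq_crossMoment]

theorem secondMoment_const_smul (c : ℝ) (x : Ω → Fin n → ℝ) :
    secondMoment P (c • x) = c ^ 2 • secondMoment P x := by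
  ext i j
  simp only [secondMoment, of_apply, Matrix.smul_apply, Pi.smul_apply, smul_eq_mul,
    ← integral_const_mul]
  congr 1 with ω
  ring

theorem secondMoment_eq_covMatrix_add [IsProbabilityMeasure P] (hx : MemLp x 2 P) :
    secondMoment P x = covMatrix P x + vecMulVec (meanVec P x) (meanVec P x) := by
  ext i j
  have hcov := covariance_eq_sub (hx.eval i) (hx.eval j)
  simp only [secondMoment, covMatrix, Matrix.add_apply, of_apply, vecMulVec_apply, meanVec, hcov,
    Pi.mul_apply, sub_add_cancel]

theorem meanVec_add [IsFiniteMeasure P] (hx : MemLp x 2 P) (hy : MemLp y 2 P) :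
    meanVec P (x + y) = meanVec P x + meanVec P y :=
  funext fun i => integral_add ((hx.eval i).integrable one_le_two)
    ((hy.eval i).integrable one_le_two)

theorem meanVec_mulVec [IsFiniteMeasure P] (hx : MemLp x 2 P) (C : Matrix (Fin n) (Fin n) ℝ) :
    meanVec P (fun ω => C *ᵥ x ω) = C *ᵥ meanVec P x := by
  ext i
  simp only [meanVec, mulVec, dotProduct]
  rw [integral_finsetSum _ fun j _ => ((hx.eval j).integrable one_le_two).const_mul _]
  simp only [integral_const_mul]

section Smul

theorem memLp_smul_of_indepFun (hx : MemLp x 2 P) (hv : MemLp v 2 P) (h : IndepFun x v P) :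
    MemLp (fun ω => v ω • x ω) 2 P := by
  refine memLp_pi_iff.2 fun i => ?_
  have hind : IndepFun (fun ω => v ω ^ 2) (fun ω => x ω i ^ 2) P :=
    (h.comp ((measurable_pi_apply i).pow_const 2) (measurable_id.pow_const 2)).symm
  refine (memLp_two_iff_integrable_sq (hv.1.mul (hx.eval i).1)).2 ?_
  simpa only [Pi.mul_apply, Pi.smul_apply, smul_eq_mul, mul_pow] using
    hind.integrable_smul hv.integrable_sq (hx.eval i).integrable_sq

theorem meanVec_smul_of_indepFun (hx : AEStronglyMeasurable x P) (hv : AEStronglyMeasurable v P)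
    (h : IndepFun x v P) : meanVec P (fun ω => v ω • x ω) = (∫ ω, v ω ∂P) • meanVec P x := by
  ext i
  exact h.symm.integral_fun_comp_mul_comp hv.aemeasurable hx.aemeasurable
    aestronglyMeasurable_id (measurable_pi_apply i).aestronglyMeasurable

theorem integral_comp_mul_mul_of_indepFun (hx : AEStronglyMeasurable x P)
    (hv : AEStronglyMeasurable v P) (h : IndepFun x v P) {f : ℝ → ℝ} (hf : Measurable f)
    (i j : Fin n) :
    ∫ ω, f (v ω) * (x ω i * x ω j) ∂P = (∫ ω, f (v ω) ∂P) * secondMoment P x i j :=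
  h.symm.integral_fun_comp_mul_comp (g := fun y : Fin n → ℝ => y i * y j) hv.aemeasurable
    hx.aemeasurable hf.aestronglyMeasurable
    ((measurable_pi_apply i).mul (measurable_pi_apply j)).aestronglyMeasurable

theorem crossMoment_smul_of_indepFun (hx : AEStronglyMeasurable x P)
    (hv : AEStronglyMeasurable v P) (h : IndepFun x v P) :
    crossMoment P x (fun ω => v ω • x ω) = (∫ ω, v ω ∂P) • secondMoment P x := by
  ext i j
  rw [Matrix.smul_apply, smul_eq_mul,
    ← integral_comp_mul_mul_of_indepFun (f := fun t => t) hx hv h measurable_id]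
  simp only [crossMoment, of_apply, Pi.smul_apply, smul_eq_mul, mul_left_comm]

theorem secondMoment_smul_of_indepFun (hx : AEStronglyMeasurable x P)
    (hv : AEStronglyMeasurable v P) (h : IndepFun x v P) :
    secondMoment P (fun ω => v ω • x ω) = (∫ ω, v ω ^ 2 ∂P) • secondMoment P x := by
  ext i j
  rw [Matrix.smul_apply, smul_eq_mul,
    ← integral_comp_mul_mul_of_indepFun (f := fun t => t ^ 2) hx hv h (measurable_id.pow_const 2)]
  simp only [secondMoment, of_apply, Pi.smul_apply, smul_eq_mul, sq, mul_mul_mul_comm]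

end Smul

end Moments

/-! ### Moments of the trajectory -/

theorem measurable_traj {Ω : Type*} {_ : MeasurableSpace Ω} {n : ℕ}
    (A A₁ : Matrix (Fin n) (Fin n) ℝ) {x0 : Ω → Fin n → ℝ} {w : ℕ → Ω → Fin n → ℝ}
    {v : ℕ → Ω → ℝ} {k : ℕ} (hx : Measurable x0) (hw : ∀ j < k, Measurable (w j))
    (hv : ∀ j < k, Measurable (v j)) :
    Measurable (traj A A₁ x0 w v k) := by
  induction k with
  | zero => exact hx
  | succ k ih =>
    have hmul (C : Matrix (Fin n) (Fin n) ℝ) : Measurable fun y : Fin n → ℝ => C *ᵥ y :=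
      Continuous.measurable (by fun_prop)
    have hk := ih (fun j hj => hw j (hj.trans k.lt_succ_self))
      fun j hj => hv j (hj.trans k.lt_succ_self)
    exact (((hmul A).comp hk).add ((hv k k.lt_succ_self).smul ((hmul A₁).comp hk))).add
      (hw k k.lt_succ_self)

theorem traj_succ_eq {Ω : Type*} {n : ℕ} (A A₁ : Matrix (Fin n) (Fin n) ℝ)
    (x0 : Ω → Fin n → ℝ) (w : ℕ → Ω → Fin n → ℝ) (v : ℕ → Ω → ℝ) (k : ℕ) :
    traj A A₁ x0 w v (k + 1) = ((fun ω => A *ᵥ traj A A₁ x0 w v k ω) +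
      fun ω => A₁ *ᵥ (v k ω • traj A A₁ x0 w v k ω)) + w k := by
  ext1 ω
  simp only [traj, Pi.add_apply, mulVec_smul]

/-- The properties of the noise that determine the first two moments of `traj`. Compared with
`NoiseAssumption`, the matrix `Sig` may be singular, so that the noise-free system in
`ExactlyDetectable` is covered by `w = 0`. -/
structure IsWhiteNoise {Ω : Type*} [MeasurableSpace Ω] {n : ℕ} (P : Measure Ω)
    (x0 : Ω → Fin n → ℝ) (w : ℕ → Ω → Fin n → ℝ) (v : ℕ → Ω → ℝ)
    (Sig : Matrix (Fin n) (Fin n) ℝ) (σ : ℝ) : Prop where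
  init_measurable : Measurable x0
  init_memLp : MemLp x0 2 P
  w_measurable : ∀ k, Measurable (w k)
  w_memLp : ∀ k, MemLp (w k) 2 P
  w_indep_past : ∀ k, IndepFun (fun ω (i : Finset.range k) => w i ω) (w k) P
  w_mean : ∀ k, meanVec P (w k) = 0
  w_secondMoment : ∀ k, secondMoment P (w k) = Sig
  v_measurable : ∀ k, Measurable (v k)
  v_memLp : ∀ k, MemLp (v k) 2 P
  v_indep_past : ∀ k, IndepFun (fun ω (i : Finset.range k) => v i ω) (v k) P
  v_mean : ∀ k, ∫ ω, v k ω ∂P = 0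
  v_sq : ∀ k, ∫ ω, v k ω ^ 2 ∂P = σ
  init_indep : IndepFun x0 (fun ω (k : ℕ) => (w k ω, v k ω)) P
  noise_indep : IndepFun (fun ω (k : ℕ) => w k ω) (fun ω (k : ℕ) => v k ω) P

section Traj

variable {Ω : Type*} [MeasurableSpace Ω] {P : Measure Ω} {n : ℕ}
  {x0 : Ω → Fin n → ℝ} {w : ℕ → Ω → Fin n → ℝ} {v : ℕ → Ω → ℝ}
  {A A₁ Sig : Matrix (Fin n) (Fin n) ℝ} {σ : ℝ}

namespace IsMultiplicativeNoise

theorem integral_sq (h : IsMultiplicativeNoise P v σ) (k : ℕ) : ∫ ω, v k ω ^ 2 ∂P = σ := by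
  rw [← h.variance_eq k, variance_of_integral_eq_zero (h.measurable k).aemeasurable
    (h.mean_zero k)]

variable [IsProbabilityMeasure P]

theorem isWhiteNoise_const (h : IsMultiplicativeNoise P v σ) (ξ : Fin n → ℝ) :
    IsWhiteNoise P (fun _ => ξ) 0 v 0 σ where
  init_measurable := measurable_const
  init_memLp := memLp_const ξ
  w_measurable _ := measurable_const
  w_memLp _ := memLp_const 0
  w_indep_past _ := indepFun_const_right _ _
  w_mean _ := by ext; simp [meanVec]
  w_secondMoment _ := by ext; simp [secondMoment]
  v_measurable := h.measurable
  v_memLp := h.memLp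
  v_indep_past := indepFun_past h.indep h.measurable
  v_mean := h.mean_zero
  v_sq := h.integral_sq
  init_indep := indepFun_const_left _ _
  noise_indep := indepFun_const_left (0 : ℕ → Fin n → ℝ) _

end IsMultiplicativeNoise

namespace NoiseAssumption

theorem const_smul (h : NoiseAssumption P x0 w v Sig σ) {c : ℝ} (hc : c ≠ 0) :
    NoiseAssumption P (c • x0) w v Sig σ where
  init_measurable := h.init_measurable.const_smul c
  init_memLp := h.init_memLp.const_smul c
  init_cov_posDef := by
    have hcov : covMatrix P (c • x0) = c ^ 2 • covMatrix P x0 := by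
      ext i j
      simp only [covMatrix, of_apply, Matrix.smul_apply, Pi.smul_apply, smul_eq_mul,
        covariance_const_mul_left, covariance_const_mul_right, sq, mul_assoc]
    exact hcov ▸ h.init_cov_posDef.smul (by positivity)
  init_indep := h.init_indep.comp (measurable_const_smul c) measurable_id
  additive := h.additive
  multiplicative := h.multiplicative
  noise_indep := h.noise_indep

variable [IsProbabilityMeasure P]

theorem isWhiteNoise (h : NoiseAssumption P x0 w v Sig σ) : IsWhiteNoise P x0 w v Sig σ where
  init_measurable := h.init_measurable
  init_memLp := h.init_memLp
  w_measurable := h.additive.measurable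
  w_memLp := h.additive.memLp
  w_indep_past := indepFun_past h.additive.indep h.additive.measurable
  w_mean := h.additive.mean_zero
  w_secondMoment k := by
    rw [secondMoment_eq_covMatrix_add (h.additive.memLp k), h.additive.mean_zero,
      h.additive.cov_eq, zero_vecMulVec, add_zero]
  v_measurable := h.multiplicative.measurable
  v_memLp := h.multiplicative.memLp
  v_indep_past := indepFun_past h.multiplicative.indep h.multiplicative.measurable
  v_mean := h.multiplicative.mean_zero
  v_sq := h.multiplicative.integral_sq
  init_indep := h.init_indep
  noise_indep := h.noise_indep

theorem posDef_secondMoment (h : NoiseAssumption P x0 w v Sig σ) :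
    (secondMoment P x0).PosDef := by
  rw [secondMoment_eq_covMatrix_add h.init_memLp]
  exact h.init_cov_posDef.add_posSemidef (posSemidef_vecMulVec_self_star (meanVec P x0))

end NoiseAssumption

variable [IsProbabilityMeasure P]

namespace IsWhiteNoise

theorem indepFun_traj_multiplicative (h : IsWhiteNoise P x0 w v Sig σ) (k : ℕ) :
    IndepFun (traj A A₁ x0 w v k) (v k) P := by
  have hw := measurable_pi_lambda (fun ω (k : ℕ) => w k ω) h.w_measurable
  have hv := measurable_pi_lambda (fun ω (k : ℕ) => v k ω) h.v_measurable
  have hvk := measurable_pi_lambda (fun ω (i : Finset.range k) => v i ω) fun i => h.v_measurable i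
  have hinit : IndepFun x0 (fun ω => (fun k => w k ω, fun k => v k ω)) P :=
    h.init_indep.comp (φ := id)
      (ψ := fun f : ℕ → (Fin n → ℝ) × ℝ => (fun k => (f k).1, fun k => (f k).2)) measurable_id
      (by fun_prop)
  have hpast := (indepFun_prodMk_left h.init_measurable hw hv hinit h.noise_indep).comp
    (φ := id) (ψ := fun f : ℕ → ℝ => (fun i : Finset.range k => f i, f k)) measurable_id
    (by fun_prop)
  let Z : Ω → ((Fin n → ℝ) × (ℕ → Fin n → ℝ)) × (Finset.range k → ℝ) :=
    fun ω => ((x0 ω, fun k => w k ω), fun i => v i ω)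
  have hZ : Measurable[MeasurableSpace.comap Z inferInstance] Z := comap_measurable Z
  refine indepFun_of_measurable_comap (a := Z) (indepFun_prodMk_left
    (h.init_measurable.prodMk hw) hvk (h.v_measurable k) hpast (h.v_indep_past k))
    (measurable_traj A A₁ hZ.fst.fst (fun j _ => ?_) fun j hj => ?_)
  · exact (measurable_pi_apply j).comp hZ.fst.snd
  · exact (measurable_pi_apply (⟨j, Finset.mem_range.2 hj⟩ : Finset.range k)).comp hZ.snd

theorem indepFun_traj_additive (h : IsWhiteNoise P x0 w v Sig σ) (k : ℕ) :
    IndepFun (fun ω => (traj A A₁ x0 w v k ω, v k ω)) (w k) P := by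
  have hw := measurable_pi_lambda (fun ω (k : ℕ) => w k ω) h.w_measurable
  have hv := measurable_pi_lambda (fun ω (k : ℕ) => v k ω) h.v_measurable
  have hwk := measurable_pi_lambda (fun ω (i : Finset.range k) => w i ω) fun i => h.w_measurable i
  have hinit : IndepFun x0 (fun ω => (fun k => v k ω, fun k => w k ω)) P :=
    h.init_indep.comp (φ := id)
      (ψ := fun f : ℕ → (Fin n → ℝ) × ℝ => (fun k => (f k).2, fun k => (f k).1)) measurable_id
      (by fun_prop)
  have hpast := (indepFun_prodMk_left h.init_measurable hv hw hinit h.noise_indep.symm).comp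
    (φ := id) (ψ := fun f : ℕ → Fin n → ℝ => (fun i : Finset.range k => f i, f k)) measurable_id
    (by fun_prop)
  let Z : Ω → ((Fin n → ℝ) × (ℕ → ℝ)) × (Finset.range k → Fin n → ℝ) :=
    fun ω => ((x0 ω, fun k => v k ω), fun i => w i ω)
  have hZ : Measurable[MeasurableSpace.comap Z inferInstance] Z := comap_measurable Z
  have hvj (j : ℕ) : Measurable[MeasurableSpace.comap Z inferInstance] (v j) :=
    (measurable_pi_apply j).comp hZ.fst.snd
  refine indepFun_of_measurable_comap (a := Z) (indepFun_prodMk_left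
    (h.init_measurable.prodMk hv) hwk (h.w_measurable k) hpast (h.w_indep_past k))
    (.prodMk (measurable_traj A A₁ hZ.fst.fst (fun j hj => ?_) fun j _ => hvj j) (hvj k))
  exact (measurable_pi_apply (⟨j, Finset.mem_range.2 hj⟩ : Finset.range k)).comp hZ.snd

theorem memLp_traj (h : IsWhiteNoise P x0 w v Sig σ) (k : ℕ) : MemLp (traj A A₁ x0 w v k) 2 P := by
  induction k with
  | zero => exact h.init_memLp
  | succ k ih =>
    have hz := memLp_smul_of_indepFun (memLp_mulVec ih A₁) (h.v_memLp k)
      ((h.indepFun_traj_multiplicative k).comp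
        (Continuous.measurable (by fun_prop : Continuous (A₁ *ᵥ ·))) measurable_id)
    exact ((memLp_mulVec ih A).add hz).add (h.w_memLp k)

theorem memLp_smul_traj (h : IsWhiteNoise P x0 w v Sig σ) (k : ℕ) :
    MemLp (fun ω => v k ω • traj A A₁ x0 w v k ω) 2 P :=
  memLp_smul_of_indepFun (h.memLp_traj k) (h.v_memLp k) (h.indepFun_traj_multiplicative k)

theorem meanVec_traj_succ (h : IsWhiteNoise P x0 w v Sig σ) (k : ℕ) :
    meanVec P (traj A A₁ x0 w v (k + 1)) = A *ᵥ meanVec P (traj A A₁ x0 w v k) := by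
  have hx : MemLp (traj A A₁ x0 w v k) 2 P := h.memLp_traj k
  have hz : MemLp (fun ω => v k ω • traj A A₁ x0 w v k ω) 2 P := h.memLp_smul_traj k
  rw [traj_succ_eq, meanVec_add ((memLp_mulVec hx A).add (memLp_mulVec hz A₁)) (h.w_memLp k),
    meanVec_add (memLp_mulVec hx A) (memLp_mulVec hz A₁), meanVec_mulVec hx, meanVec_mulVec hz,
    meanVec_smul_of_indepFun hx.1 (h.v_memLp k).1 (h.indepFun_traj_multiplicative k), h.v_mean,
    h.w_mean, zero_smul, mulVec_zero, add_zero, add_zero]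

theorem secondMoment_traj_succ (h : IsWhiteNoise P x0 w v Sig σ) (k : ℕ) :
    secondMoment P (traj A A₁ x0 w v (k + 1)) =
      lyapMap A A₁ σ (secondMoment P (traj A A₁ x0 w v k)) + Sig := by
  have hx : MemLp (traj A A₁ x0 w v k) 2 P := h.memLp_traj k
  have hz : MemLp (fun ω => v k ω • traj A A₁ x0 w v k ω) 2 P := h.memLp_smul_traj k
  have hv := (h.v_memLp k).1
  have hind : IndepFun (traj A A₁ x0 w v k) (v k) P := h.indepFun_traj_multiplicative k
  have hxz : crossMoment P (fun ω => A *ᵥ traj A A₁ x0 w v k ω)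
      (fun ω => A₁ *ᵥ (v k ω • traj A A₁ x0 w v k ω)) = 0 := by
    rw [crossMoment_mulVec_mulVec hx hz, crossMoment_smul_of_indepFun hx.1 hv hind, h.v_mean,
      zero_smul, Matrix.mul_zero, Matrix.zero_mul]
  have hw : crossMoment P ((fun ω => A *ᵥ traj A A₁ x0 w v k ω) +
      fun ω => A₁ *ᵥ (v k ω • traj A A₁ x0 w v k ω)) (w k) = 0 := by
    have hstep : Continuous fun p : (Fin n → ℝ) × ℝ => A *ᵥ p.1 + A₁ *ᵥ (p.2 • p.1) := by fun_prop
    exact crossMoment_eq_zero_of_indepFun ((memLp_mulVec hx A).add (memLp_mulVec hz A₁)).1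
      (h.w_memLp k).1 ((h.indepFun_traj_additive k).comp hstep.measurable measurable_id)
      (congrFun (h.w_mean k))
  rw [traj_succ_eq, secondMoment_add ((memLp_mulVec hx A).add (memLp_mulVec hz A₁)) (h.w_memLp k)
    hw, secondMoment_add (memLp_mulVec hx A) (memLp_mulVec hz A₁) hxz, h.w_secondMoment,
    secondMoment_eq_crossMoment, secondMoment_eq_crossMoment, crossMoment_mulVec_mulVec hx hx,
    crossMoment_mulVec_mulVec hz hz, ← secondMoment_eq_crossMoment, ← secondMoment_eq_crossMoment,
    secondMoment_smul_of_indepFun hx.1 hv hind, h.v_sq, lyapMap_apply, Matrix.mul_smul,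
    Matrix.smul_mul]

theorem secondMoment_traj (h : IsWhiteNoise P x0 w v Sig σ) (k : ℕ) :
    secondMoment P (traj A A₁ x0 w v k) = (lyapMap A A₁ σ ^ k) (secondMoment P x0) +
      ∑ j ∈ Finset.range k, (lyapMap A A₁ σ ^ j) Sig := by
  induction k with
  | zero => simp [traj]
  | succ k ih =>
    rw [h.secondMoment_traj_succ, ih, map_add, map_sum, Finset.sum_range_succ', pow_succ']
    simp only [pow_succ', Module.End.mul_apply, pow_zero, Module.End.one_apply, add_assoc]

theorem vecMulVec_meanVec_traj_le (h : IsWhiteNoise P x0 w v Sig σ) (hσ : 0 ≤ σ) (k : ℕ) :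
    vecMulVec (meanVec P (traj A A₁ x0 w v k)) (meanVec P (traj A A₁ x0 w v k)) ≤
      (lyapMap A A₁ σ ^ k) (vecMulVec (meanVec P x0) (meanVec P x0)) := by
  induction k with
  | zero => exact le_rfl
  | succ k ih =>
    set m := meanVec P (traj A A₁ x0 w v k) with hm
    calc vecMulVec (meanVec P (traj A A₁ x0 w v (k + 1))) (meanVec P (traj A A₁ x0 w v (k + 1)))
        = A * vecMulVec m m * Aᵀ := by
          rw [h.meanVec_traj_succ, ← hm, mul_vecMulVec, vecMulVec_mul, vecMul_transpose]
      _ ≤ lyapMap A A₁ σ (vecMulVec m m) := by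
          rw [lyapMap_apply]
          exact le_add_of_nonneg_right (nonneg_iff_posSemidef.2
            ((posSemidef_mul_mul_transpose (posSemidef_vecMulVec_self_star m) A₁).smul hσ))
      _ ≤ _ := by
          rw [pow_succ', Module.End.mul_apply]
          exact (posMap_lyapMap A A₁ hσ).mono ih

end IsWhiteNoise

end Traj

/-! ### Mean square stability and detectability -/

section Stability

variable {Ω : Type u} [MeasurableSpace Ω] {P : Measure Ω} [IsProbabilityMeasure P] {n : ℕ}
  {x0 : Ω → Fin n → ℝ} {w : ℕ → Ω → Fin n → ℝ} {v : ℕ → Ω → ℝ}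
  {A A₁ Sig Q : Matrix (Fin n) (Fin n) ℝ} {σ : ℝ}

theorem NoiseAssumption.tendsto_meanVec_traj (hn : NoiseAssumption P x0 w v Sig σ)
    (h : PowStable (lyapMap A A₁ σ)) :
    Tendsto (fun k => meanVec P (traj A A₁ x0 w v k)) atTop (𝓝 0) := by
  have hsq := tendsto_zero_of_le (fun k => posSemidef_vecMulVec_self_star _)
    (hn.isWhiteNoise.vecMulVec_meanVec_traj_le hn.multiplicative.variance_pos.le)
    (h _ (posSemidef_vecMulVec_self_star _))
  refine tendsto_pi_nhds.2 fun i => (tendsto_zero_iff_abs_tendsto_zero _).2 ?_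
  simpa [Function.comp_def, vecMulVec_apply, Real.sqrt_mul_self_eq_abs] using
    (tendsto_pi_nhds.1 (tendsto_pi_nhds.1 hsq i) i).sqrt

theorem meanSquareStable_of_powStable (h : PowStable (lyapMap A A₁ σ)) :
    MeanSquareStable.{u} A A₁ Sig σ := by
  intro Ω _ P _ w v
  refine ⟨0, limUnder atTop fun N => ∑ j ∈ Finset.range N, (lyapMap A A₁ σ ^ j) Sig,
    fun x0 hn => ⟨hn.tendsto_meanVec_traj h, ?_⟩⟩
  obtain ⟨X, -, -, hX⟩ := h.exists_eq_add_apply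
    (posMap_lyapMap A A₁ hn.multiplicative.variance_pos.le) hn.additive.cov_posDef.posSemidef
  rw [hX.tendsto_sum_nat.limUnder_eq]
  simpa only [hn.isWhiteNoise.secondMoment_traj, zero_add] using
    (h _ hn.posDef_secondMoment.posSemidef).add hX.tendsto_sum_nat

/-- The limits for the initial states `x0` and `2 • x0` coincide, while the second moments differ
by three times the homogeneous evolution of `secondMoment P x0`. -/
theorem MeanSquareStable.powStable (h : MeanSquareStable.{u} A A₁ Sig σ)
    (hn : NoiseAssumption P x0 w v Sig σ) : PowStable (lyapMap A A₁ σ) := by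
  obtain ⟨_, X, hX⟩ := h Ω P w v
  have hn₂ := hn.const_smul two_ne_zero
  have hdiff (k : ℕ) : secondMoment P (traj A A₁ ((2 : ℝ) • x0) w v k) -
      secondMoment P (traj A A₁ x0 w v k) =
        (3 : ℝ) • (lyapMap A A₁ σ ^ k) (secondMoment P x0) := by
    rw [hn.isWhiteNoise.secondMoment_traj, hn₂.isWhiteNoise.secondMoment_traj,
      secondMoment_const_smul, map_smul, add_sub_add_right_eq_sub]
    module
  refine .of_posDef (posMap_lyapMap A A₁ hn.multiplicative.variance_pos.le)
    hn.posDef_secondMoment ?_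
  simpa only [hdiff, inv_smul_smul₀ (three_ne_zero' ℝ), sub_self, smul_zero] using
    ((hX _ hn₂).2.sub (hX _ hn).2).const_smul (3 : ℝ)⁻¹

theorem dotProduct_psdSqrt_mulVec_self (hQ : Q.PosSemidef) (y : Fin n → ℝ) :
    psdSqrt Q *ᵥ y ⬝ᵥ psdSqrt Q *ᵥ y = y ⬝ᵥ Q *ᵥ y := by
  have hsq : psdSqrt Q * psdSqrt Q = Q := CFC.sqrt_mul_sqrt_self Q (nonneg_iff_posSemidef.2 hQ)
  have hsymm : (psdSqrt Q).IsSymm :=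
    isSymm_of_posSemidef (nonneg_iff_posSemidef.1 (CFC.sqrt_nonneg Q))
  rw [dotProduct_mulVec, vecMul_mulVec, hsymm.eq, hsq, dotProduct_comm, ← mulVec_transpose,
    (isSymm_of_posSemidef hQ).eq]

namespace ExactlyDetectable

theorem tendsto_trace_vecMulVec (h : ExactlyDetectable.{u} A A₁ (psdSqrt Q) σ) (hQ : Q.PosSemidef)
    (hv : IsMultiplicativeNoise P v σ) {ξ : Fin n → ℝ}
    (hzero : ∀ k, (Q * (lyapMap A A₁ σ ^ k) (vecMulVec ξ ξ)).trace = 0) :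
    Tendsto (fun k => ((lyapMap A A₁ σ ^ k) (vecMulVec ξ ξ)).trace) atTop (𝓝 0) := by
  set x := traj A A₁ (fun _ : Ω => ξ) 0 v with hx
  have hnoise := hv.isWhiteNoise_const ξ
  have hmem (k : ℕ) : MemLp (x k) 2 P := hnoise.memLp_traj k
  have hmoment (k : ℕ) : secondMoment P (x k) = (lyapMap A A₁ σ ^ k) (vecMulVec ξ ξ) := by
    have hinit : secondMoment P (fun _ => ξ) = vecMulVec ξ ξ := by
      ext
      simp [secondMoment, vecMulVec_apply]
    simp [hx, hnoise.secondMoment_traj, hinit]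
  refine (h Ω P v hv ξ fun k => ?_).congr fun k => ?_
  · have hout : ∫ ω, x k ω ⬝ᵥ Q *ᵥ x k ω ∂P = 0 := by
      rw [integral_dotProduct_mulVec (hmem k), hmoment, hzero]
    have hnonneg (y : Fin n → ℝ) : 0 ≤ y ⬝ᵥ Q *ᵥ y :=
      (posSemidef_iff_isSymm_dotProduct_mulVec.1 hQ).2 y
    filter_upwards [(integral_eq_zero_iff_of_nonneg (fun ω => hnonneg _)
      (integrable_dotProduct (hmem k) (memLp_mulVec (hmem k) Q))).1 hout] with ω hω
    exact dotProduct_self_eq_zero.1 ((dotProduct_psdSqrt_mulVec_self hQ _).trans hω)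
  · rw [integral_dotProduct (hmem k) (hmem k), ← secondMoment_eq_crossMoment, hmoment]

theorem tendsto_trace (h : ExactlyDetectable.{u} A A₁ (psdSqrt Q) σ) (hQ : Q.PosSemidef)
    (hv : IsMultiplicativeNoise P v σ) {Y : Matrix (Fin n) (Fin n) ℝ} (hY : Y.PosSemidef)
    (hzero : ∀ k, (Q * (lyapMap A A₁ σ ^ k) Y).trace = 0) :
    Tendsto (fun k => ((lyapMap A A₁ σ ^ k) Y).trace) atTop (𝓝 0) := by
  obtain ⟨ξ, rfl⟩ := exists_eq_sum_vecMulVec_self hY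
  have hterm (k : ℕ) (i : Fin n) :
      (Q * (lyapMap A A₁ σ ^ k) (vecMulVec (ξ i) (ξ i))).trace = 0 := by
    have hsum := hzero k
    rw [map_sum, Finset.mul_sum, trace_sum, Finset.sum_eq_zero_iff_of_nonneg] at hsum
    · exact hsum i (Finset.mem_univ i)
    · exact fun i _ => trace_mul_nonneg hQ ((posMap_lyapMap A A₁ hv.variance_pos.le).pow k _
        (posSemidef_vecMulVec_self_star (ξ i)))
  simpa only [map_sum, trace_sum, Finset.sum_const_zero] using
    tendsto_finsetSum Finset.univ fun i _ => h.tendsto_trace_vecMulVec hQ hv fun k => hterm k i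

end ExactlyDetectable

end Stability

namespace Data

variable {n m : ℕ} {S : Data n m} {L : Matrix (Fin m) (Fin n) ℝ} {Y : Matrix (Fin n) (Fin n) ℝ}

theorem trace_mul_eq_zero_of_trace_stageCost_mul_le (hY : Y.PosSemidef)
    (h : (S.stageCost L * Y).trace ≤ 0) : (S.Q * Y).trace = 0 ∧ L * Y = 0 := by
  have hLY := posSemidef_mul_mul_transpose hY L
  have hR : (Lᵀ * S.R * L * Y).trace = (S.R * (L * Y * Lᵀ)).trace := by
    rw [Matrix.mul_assoc Lᵀ, Matrix.mul_assoc Lᵀ, trace_mul_comm]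
    simp only [Matrix.mul_assoc]
  rw [stageCost, Matrix.add_mul, trace_add, hR] at h
  have hQ₀ := trace_mul_nonneg S.Q_posSemidef hY
  have hR₀ := trace_mul_nonneg S.R_posDef.posSemidef hLY
  exact ⟨by linarith, mul_eq_zero_of_mul_mul_transpose_eq_zero hY
    (eq_zero_of_trace_mul_le_zero S.R_posDef hLY (by linarith))⟩

theorem closedLoop_apply_of_mul_eq_zero (hY : Y.IsSymm) (h : L * Y = 0) :
    S.closedLoop L Y = lyapMap S.A S.A₁ S.σ Y := by
  have h' : Y * Lᵀ = 0 := by simpa [hY.eq] using congrArg transpose h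
  have hconj (A : Matrix (Fin n) (Fin n) ℝ) (B : Matrix (Fin n) (Fin m) ℝ) :
      (A + B * L) * Y * (A + B * L)ᵀ = A * Y * Aᵀ := by
    rw [Matrix.add_mul, Matrix.mul_assoc B, h, Matrix.mul_zero, add_zero, transpose_add,
      transpose_mul, Matrix.mul_add, Matrix.mul_assoc A Y (Lᵀ * Bᵀ), ← Matrix.mul_assoc Y, h',
      Matrix.zero_mul, Matrix.mul_zero, add_zero]
  rw [closedLoop, lyapMap_apply, lyapMap_apply, hconj, hconj]

/-- An unstable eigenvector of the closed loop must have zero cost, so it evolves in open loop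
without being seen by the output, which detectability forbids. -/
theorem powStable_of_exactlyDetectable {Ω : Type u} [MeasurableSpace Ω] {μ : Measure Ω}
    [IsProbabilityMeasure μ] {v : ℕ → Ω → ℝ} (hv : IsMultiplicativeNoise μ v S.σ)
    (hdet : ExactlyDetectable.{u} S.A S.A₁ (psdSqrt S.Q) S.σ) {P : Matrix (Fin n) (Fin n) ℝ}
    (hP : P.PosSemidef) (heq : P = S.stageCost L + S.α • S.closedLoopAdj L P) :
    PowStable (S.α • S.closedLoop L) := by
  by_contra hunstable
  obtain ⟨r, Y, hr, hY, hY₁, hYr⟩ :=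
    ((posMap_closedLoop hv.variance_pos.le L).smul S.α_pos.le).exists_eigenvector hunstable
  have hvalue : (P * Y).trace = (S.stageCost L * Y).trace + r * (P * Y).trace := by
    conv_lhs => rw [heq]
    rw [Matrix.add_mul, trace_add, Matrix.smul_mul, trace_smul, trace_closedLoopAdj_mul,
      ← trace_smul, ← Matrix.mul_smul, ← LinearMap.smul_apply, hYr, Matrix.mul_smul, trace_smul,
      smul_eq_mul]
  obtain ⟨hQY, hLY⟩ := trace_mul_eq_zero_of_trace_stageCost_mul_le (S := S) (L := L) hY
    (by nlinarith [trace_mul_nonneg hP hY])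
  have hopen : lyapMap S.A S.A₁ S.σ Y = (r / S.α) • Y := by
    rw [← closedLoop_apply_of_mul_eq_zero (isSymm_of_posSemidef hY) hLY, div_eq_inv_mul, mul_smul,
      ← hYr, LinearMap.smul_apply, inv_smul_smul₀ S.α_pos.ne']
  have hpow (k : ℕ) : (lyapMap S.A S.A₁ S.σ ^ k) Y = (r / S.α) ^ k • Y := by
    induction k with
    | zero => simp
    | succ k ih => rw [pow_succ', Module.End.mul_apply, ih, map_smul, hopen, smul_smul, pow_succ]
  have hlim := hdet.tendsto_trace S.Q_posSemidef hv hY fun k => by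
    rw [hpow, Matrix.mul_smul, trace_smul, hQY, smul_zero]
  refine absurd (ge_of_tendsto' hlim (b := 1) fun k => ?_) (by norm_num)
  rw [hpow, trace_smul, hY₁, smul_eq_mul, mul_one]
  exact one_le_pow₀ ((one_le_div S.α_pos).2 (S.α_lt_one.le.trans hr))

end Data

/-! ### The dual problem -/

namespace Data

variable {n m : ℕ} {S : Data n m} {L : Matrix (Fin m) (Fin n) ℝ} {P X₀ M : Matrix (Fin n) (Fin n) ℝ}
  {F : Matrix (Fin n ⊕ Fin m) (Fin n ⊕ Fin m) ℝ}

theorem IsRiccatiSolution.eq_stageCost_add (hσ : 0 ≤ S.σ) (h : S.IsRiccatiSolution P) :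
    P = S.stageCost (gain (S.H P)) + S.α • S.closedLoopAdj (gain (S.H P)) P := by
  rw [← S.restrictGraph_H _ (isSymm_of_posSemidef h.1),
    restrictGraph_gain (isSymm_H h.1) (posDef_toBlocks₂₂_H hσ h.1)]
  exact (isRiccatiSolution_iff.1 h).2

theorem DualFeasible.schur_le_stageCost_add (hF : S.DualFeasible F M)
    (L : Matrix (Fin m) (Fin n) ℝ) :
    schur F ≤ S.stageCost L + S.α • S.closedLoopAdj L (schur F) :=
  calc schur F ≤ restrictGraph L F := schur_le_restrictGraph hF.symm hF.posDef L
    _ ≤ restrictGraph L (S.bellman (schur F)) :=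
      restrictGraph_mono (lmi_posSemidef_iff.1 hF.lmi) L
    _ = S.stageCost L + S.α • S.closedLoopAdj L (schur F) := S.restrictGraph_bellman L (schur F)

theorem powStable_smul_closedLoopAdj (hσ : 0 ≤ S.σ) (h : PowStable (S.α • S.closedLoop L)) :
    PowStable (S.α • S.closedLoopAdj L) :=
  h.adjoint ((posMap_closedLoopAdj hσ L).smul S.α_pos.le) fun X Y => by
    simp only [LinearMap.smul_apply, Matrix.smul_mul, Matrix.mul_smul, trace_smul,
      trace_closedLoopAdj_mul]

theorem DualFeasible.schur_le (hσ : 0 ≤ S.σ) (hF : S.DualFeasible F M)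
    (hL : PowStable (S.α • S.closedLoop L)) (hP : P.IsSymm)
    (heq : P = S.stageCost L + S.α • S.closedLoopAdj L P) : schur F ≤ P := by
  refine (powStable_smul_closedLoopAdj hσ hL).posSemidef_of_apply_le
    ((posMap_closedLoopAdj hσ L).smul S.α_pos.le) (hP.sub (isSymm_schur hF.symm)) ?_
  calc (S.α • S.closedLoopAdj L) (P - schur F)
      = P - (S.stageCost L + S.α • S.closedLoopAdj L (schur F)) := by
        rw [map_sub, LinearMap.smul_apply, LinearMap.smul_apply, eq_sub_iff_add_eq.2
          ((add_comm _ _).trans heq.symm), sub_sub]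
    _ ≤ P - schur F := sub_le_sub_left (hF.schur_le_stageCost_add L) P

theorem IsRiccatiSolution.dualOptimal (hσ : 0 ≤ S.σ) (h : S.IsRiccatiSolution P)
    (hstable : PowStable (S.α • S.closedLoop (gain (S.H P))))
    (hX : (X₀ + (S.α / (1 - S.α)) • S.Sig).PosSemidef) : S.DualOptimal X₀ (S.H P) P := by
  refine ⟨h.dualFeasible hσ, fun F M hF => trace_mul_le_trace_mul hX ?_⟩
  exact (le_iff.2 hF.schur_ge).trans <|
    hF.schur_le hσ hstable (isSymm_of_posSemidef h.1) (h.eq_stageCost_add hσ)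

theorem DualOptimal.schur_eq (hσ : 0 ≤ S.σ) (hF : S.DualOptimal X₀ F M)
    (h : S.IsRiccatiSolution P) (hstable : PowStable (S.α • S.closedLoop (gain (S.H P))))
    (hX : (X₀ + (S.α / (1 - S.α)) • S.Sig).PosDef) : schur F = P := by
  have hMF : M ≤ schur F := le_iff.2 hF.1.schur_ge
  have hFP : schur F ≤ P :=
    hF.1.schur_le hσ hstable (isSymm_of_posSemidef h.1) (h.eq_stageCost_add hσ)
  have hPM : P - M = 0 := by
    refine eq_zero_of_trace_mul_le_zero hX (le_iff.1 (hMF.trans hFP)) ?_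
    rw [Matrix.mul_sub, trace_sub, sub_nonpos]
    exact hF.2 _ _ (h.dualFeasible hσ)
  exact hFP.antisymm ((sub_eq_zero.1 hPM).trans_le hMF)

theorem DualOptimal.gain_eq (hσ : 0 ≤ S.σ) (hF : S.DualOptimal X₀ F M)
    (h : S.IsRiccatiSolution P) (hstable : PowStable (S.α • S.closedLoop (gain (S.H P))))
    (hX : (X₀ + (S.α / (1 - S.α)) • S.Sig).PosDef) : gain F = gain (S.H P) := by
  set K := gain (S.H P)
  have hschur : schur F = P := hF.schur_eq hσ h hstable hX
  have hK : restrictGraph K F ≤ schur F := by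
    have hmono := restrictGraph_mono (lmi_posSemidef_iff.1 hF.1.lmi) K
    rwa [restrictGraph_bellman, hschur, ← h.eq_stageCost_add hσ, ← hschur] at hmono
  have hsquare := restrictGraph_eq_schur_add hF.1.symm hF.1.posDef.isUnit K
  rw [hK.antisymm (schur_le_restrictGraph hF.1.symm hF.1.posDef K), left_eq_add] at hsquare
  exact (sub_eq_zero.1 (eq_zero_of_transpose_mul_mul_eq_zero hF.1.posDef hsquare)).symm

end Data

/-! ### The discounted cost -/

namespace Data

variable {n m : ℕ} {S : Data n m} {Ω : Type u} [MeasurableSpace Ω] {μ : Measure Ω}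
  [IsProbabilityMeasure μ] {x0 : Ω → Fin n → ℝ} {w : ℕ → Ω → Fin n → ℝ} {v : ℕ → Ω → ℝ}
  {L : Matrix (Fin m) (Fin n) ℝ} {P D : Matrix (Fin n) (Fin n) ℝ}

theorem admissible_iff_powStable (hn : NoiseAssumption μ x0 w v S.Sig S.σ) :
    Admissible.{u} S L ↔ PowStable (S.closedLoop L) :=
  ⟨fun h => MeanSquareStable.powStable h hn, fun h => meanSquareStable_of_powStable h⟩

theorem eventually_powStable_closedLoop (hσ : 0 ≤ S.σ) (h : PowStable (S.closedLoop L)) :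
    ∀ᶠ L' in 𝓝 L, PowStable (S.closedLoop L') := by
  refine h.eventually (posMap_closedLoop hσ L) (.of_forall (posMap_closedLoop hσ)) fun X => ?_
  have hcont : Continuous fun L' => S.closedLoop L' X := by
    simp only [closedLoop, lyapMap_apply]
    fun_prop
  exact hcont.tendsto L

/-- The second moment of the closed-loop state at time `k`. -/
noncomputable def stateMoment (S : Data n m) (μ : Measure Ω) (x0 : Ω → Fin n → ℝ)
    (w : ℕ → Ω → Fin n → ℝ) (v : ℕ → Ω → ℝ) (L : Matrix (Fin m) (Fin n) ℝ) (k : ℕ) :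
    Matrix (Fin n) (Fin n) ℝ :=
  secondMoment μ (traj (S.A + S.B * L) (S.A₁ + S.B₁ * L) x0 w v k)

theorem cost_eq_tsum (hn : NoiseAssumption μ x0 w v S.Sig S.σ) (L : Matrix (Fin m) (Fin n) ℝ) :
    S.cost μ x0 w v L =
      ∑' k, S.α ^ k * (S.stageCost L * S.stateMoment μ x0 w v L k).trace := by
  have hrun (x : Fin n → ℝ) : Sum.elim x (L *ᵥ x) ⬝ᵥ S.W *ᵥ Sum.elim x (L *ᵥ x) =
      x ⬝ᵥ S.stageCost L *ᵥ x := by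
    have hgraph : fromRows (1 : Matrix (Fin n) (Fin n) ℝ) L *ᵥ x = Sum.elim x (L *ᵥ x) := by
      rw [fromRows_mulVec, one_mulVec]
    rw [← restrictGraph_W, restrictGraph_apply, ← hgraph, ← mulVec_mulVec, ← mulVec_mulVec,
      dotProduct_mulVec x, vecMul_transpose]
  refine tsum_congr fun k => ?_
  simp only [hrun]
  rw [integral_dotProduct_mulVec (hn.isWhiteNoise.memLp_traj k), stateMoment]

theorem summable_pow_mul_trace_stateMoment (hn : NoiseAssumption μ x0 w v S.Sig S.σ)
    (h : PowStable (S.closedLoop L)) (D : Matrix (Fin n) (Fin n) ℝ) :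
    Summable fun k => S.α ^ k * (D * S.stateMoment μ x0 w v L k).trace := by
  obtain ⟨_, X, hX⟩ := (admissible_iff_powStable hn).2 h Ω μ w v
  obtain ⟨b, hb⟩ := (tendsto_trace ((hX x0 hn).2.const_mul D)).abs.bddAbove_range
  refine .of_norm_bounded
    ((summable_geometric_of_lt_one S.α_pos.le S.α_lt_one).mul_right b) fun k => ?_
  rw [norm_mul, norm_pow, Real.norm_of_nonneg S.α_pos.le]
  exact mul_le_mul_of_nonneg_left (hb ⟨k, rfl⟩) (pow_nonneg S.α_pos.le k)

/-- The summands telescope: with `c = α / (1 - α) tr (P Σ)`, the `k`-th one is the decrease of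
`αᵏ (tr (P Xₖ) + c)`. -/
theorem hasSum_pow_mul_trace_stateMoment (hn : NoiseAssumption μ x0 w v S.Sig S.σ)
    (h : PowStable (S.closedLoop L)) (P : Matrix (Fin n) (Fin n) ℝ) :
    HasSum (fun k => S.α ^ k *
        ((P - S.α • S.closedLoopAdj L P) * S.stateMoment μ x0 w v L k).trace)
      (((secondMoment μ x0 + (S.α / (1 - S.α)) • S.Sig) * P).trace) := by
  set c := S.α / (1 - S.α) * (P * S.Sig).trace with hc
  have hα : 1 - S.α ≠ 0 := (sub_pos.2 S.α_lt_one).ne'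
  have hfix : S.α * (P * S.Sig).trace + S.α * c = c := by
    rw [hc]
    field_simp
    ring
  let f (k : ℕ) : ℝ := S.α ^ k * (P * S.stateMoment μ x0 w v L k).trace + S.α ^ k * c
  have hstep (k : ℕ) : S.α ^ k *
      ((P - S.α • S.closedLoopAdj L P) * S.stateMoment μ x0 w v L k).trace = f k - f (k + 1) := by
    simp only [f, stateMoment, hn.isWhiteNoise.secondMoment_traj_succ]
    rw [Matrix.sub_mul, trace_sub, Matrix.smul_mul, trace_smul, trace_closedLoopAdj_mul, closedLoop,
      Matrix.mul_add, trace_add, smul_eq_mul, pow_succ]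
    linear_combination S.α ^ k * hfix
  have hinit : ((secondMoment μ x0 + (S.α / (1 - S.α)) • S.Sig) * P).trace = f 0 := by
    simp only [f, pow_zero, one_mul, hc]
    rw [trace_mul_comm, Matrix.mul_add, trace_add, Matrix.mul_smul, trace_smul, smul_eq_mul]
    rfl
  have hlim : Tendsto f atTop (𝓝 0) := by
    simpa using (summable_pow_mul_trace_stateMoment hn h P).tendsto_atTop_zero.add
      ((tendsto_pow_atTop_nhds_zero_of_lt_one S.α_pos.le S.α_lt_one).mul_const c)
  rw [hinit, (summable_pow_mul_trace_stateMoment hn h _).hasSum_iff_tendsto_nat]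
  simpa only [hstep, Finset.sum_range_sub', sub_zero] using hlim.const_sub (f 0)

theorem cost_add_tsum_eq (hn : NoiseAssumption μ x0 w v S.Sig S.σ) (h : PowStable (S.closedLoop L))
    (heq : P = S.stageCost L + D + S.α • S.closedLoopAdj L P) :
    S.cost μ x0 w v L + ∑' k, S.α ^ k * (D * S.stateMoment μ x0 w v L k).trace =
      ((secondMoment μ x0 + (S.α / (1 - S.α)) • S.Sig) * P).trace := by
  rw [cost_eq_tsum hn, ← (summable_pow_mul_trace_stateMoment hn h _).tsum_add
    (summable_pow_mul_trace_stateMoment hn h D),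
    ← (hasSum_pow_mul_trace_stateMoment hn h P).tsum_eq, sub_eq_of_eq_add heq]
  simp only [Matrix.add_mul, trace_add, mul_add]

theorem cost_eq (hn : NoiseAssumption μ x0 w v S.Sig S.σ) (h : PowStable (S.closedLoop L))
    (heq : P = S.stageCost L + S.α • S.closedLoopAdj L P) :
    S.cost μ x0 w v L = ((secondMoment μ x0 + (S.α / (1 - S.α)) • S.Sig) * P).trace := by
  simpa using cost_add_tsum_eq (D := 0) hn h (by rwa [add_zero])

theorem cost_add_trace_le (hn : NoiseAssumption μ x0 w v S.Sig S.σ)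
    (h : PowStable (S.closedLoop L)) (hD : D.PosSemidef)
    (heq : P = S.stageCost L + D + S.α • S.closedLoopAdj L P) :
    S.cost μ x0 w v L + (D * secondMoment μ x0).trace ≤
      ((secondMoment μ x0 + (S.α / (1 - S.α)) • S.Sig) * P).trace := by
  rw [← cost_add_tsum_eq hn h heq, add_le_add_iff_left]
  simpa [stateMoment, traj] using (summable_pow_mul_trace_stateMoment hn h D).le_tsum 0 fun k _ =>
    mul_nonneg (pow_nonneg S.α_pos.le k)
      (trace_mul_nonneg hD (posSemidef_secondMoment (hn.isWhiteNoise.memLp_traj k)))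

theorem exists_eq_stageCost_add (hσ : 0 ≤ S.σ) (h : PowStable (S.closedLoop L)) :
    ∃ P : Matrix (Fin n) (Fin n) ℝ, P.PosSemidef ∧
      P = S.stageCost L + S.α • S.closedLoopAdj L P := by
  obtain ⟨P, hP, heq, -⟩ := PowStable.exists_eq_add_apply
    ((posMap_closedLoopAdj hσ L).smul S.α_pos.le)
    (powStable_smul_closedLoopAdj hσ (h.smul (posMap_closedLoop hσ L) S.α_pos.le S.α_lt_one.le))
    (S.posSemidef_stageCost L)
  exact ⟨P, hP, heq⟩

/-! ### Policy improvement -/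

theorem eq_schur_add (hσ : 0 ≤ S.σ) (hP : P.PosSemidef)
    (heq : P = S.stageCost L + S.α • S.closedLoopAdj L P) :
    P = schur (S.H P) + (L - gain (S.H P))ᵀ * (S.H P).toBlocks₂₂ * (L - gain (S.H P)) := by
  rw [← restrictGraph_eq_schur_add (isSymm_H hP) (posDef_toBlocks₂₂_H hσ hP).isUnit,
    S.restrictGraph_H L (isSymm_of_posSemidef hP)]
  exact heq

/-- The value of `L` seen from a gain between `L` and the improved gain `gain (S.H P)`. -/
theorem eq_stageCost_gain_add_smul_add (hσ : 0 ≤ S.σ) (hP : P.PosSemidef)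
    (heq : P = S.stageCost L + S.α • S.closedLoopAdj L P) (s : ℝ) :
    P = S.stageCost (gain (S.H P) + s • (L - gain (S.H P))) +
      (1 - s ^ 2) • ((L - gain (S.H P))ᵀ * (S.H P).toBlocks₂₂ * (L - gain (S.H P))) +
      S.α • S.closedLoopAdj (gain (S.H P) + s • (L - gain (S.H P))) P := by
  have hL := eq_schur_add hσ hP heq
  set K := gain (S.H P)
  have hs : S.stageCost (K + s • (L - K)) + S.α • S.closedLoopAdj (K + s • (L - K)) P =
      schur (S.H P) + s ^ 2 • ((L - K)ᵀ * (S.H P).toBlocks₂₂ * (L - K)) := by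
    rw [← S.restrictGraph_H _ (isSymm_of_posSemidef hP),
      restrictGraph_eq_schur_add (isSymm_H hP) (posDef_toBlocks₂₂_H hσ hP).isUnit,
      add_sub_cancel_left, transpose_smul, Matrix.smul_mul, Matrix.smul_mul, Matrix.mul_smul,
      smul_smul, sq]
  rw [add_right_comm, hs, add_assoc, ← add_smul, add_sub_cancel, one_smul]
  exact hL

theorem exists_powStable_add_smul_sub (hσ : 0 ≤ S.σ) (h : PowStable (S.closedLoop L))
    (K : Matrix (Fin m) (Fin n) ℝ) :
    ∃ s ∈ Set.Ioo (0 : ℝ) 1, PowStable (S.closedLoop (K + s • (L - K))) := by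
  have hcont : Continuous fun s : ℝ => K + s • (L - K) := by fun_prop
  have hlim : Tendsto (fun s : ℝ => K + s • (L - K)) (𝓝[<] 1) (𝓝 L) := by
    simpa using (hcont.tendsto 1).mono_left nhdsWithin_le_nhds
  obtain ⟨s, hs, hs₁⟩ := ((hlim.eventually (eventually_powStable_closedLoop hσ h)).and
    (Ioo_mem_nhdsLT one_pos)).exists
  exact ⟨s, hs₁, hs⟩

/-- Moving an optimal gain towards the improved gain cannot lower the cost, so the two agree. -/
theorem IsOptimalGain.exists_isRiccatiSolution (hn : NoiseAssumption μ x0 w v S.Sig S.σ)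
    (hL : S.IsOptimalGain μ x0 w v L) : ∃ P, S.IsRiccatiSolution P ∧ L = gain (S.H P) := by
  have hσ := hn.multiplicative.variance_pos.le
  have hstable := (admissible_iff_powStable hn).1 hL.1
  obtain ⟨P, hP, heq⟩ := exists_eq_stageCost_add hσ hstable
  have hschur := eq_schur_add hσ hP heq
  have hH := posDef_toBlocks₂₂_H hσ hP
  set K := gain (S.H P)
  set E := (L - K)ᵀ * (S.H P).toBlocks₂₂ * (L - K)
  obtain ⟨s, ⟨hs₀, hs₁⟩, hs⟩ := exists_powStable_add_smul_sub hσ hstable K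
  have hpos : 0 < 1 - s ^ 2 := sub_pos.2 (pow_lt_one₀ hs₀.le hs₁ two_ne_zero)
  have hD : ((1 - s ^ 2) • E).PosSemidef :=
    (posSemidef_transpose_mul_mul hH.posSemidef (L - K)).smul hpos.le
  have hmin := hL.2 _ ((admissible_iff_powStable hn).2 hs)
  have hcost := cost_add_trace_le hn hs hD (eq_stageCost_gain_add_smul_add hσ hP heq s)
  rw [← cost_eq hn hstable heq, trace_mul_comm] at hcost
  have hE : E = 0 := by
    refine (smul_eq_zero.1 (eq_zero_of_trace_mul_le_zero hn.posDef_secondMoment hD ?_)).resolve_left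
      hpos.ne'
    linarith
  rw [hE, add_zero] at hschur
  exact ⟨P, isRiccatiSolution_iff.2 ⟨hP, hschur⟩,
    sub_eq_zero.1 (eq_zero_of_transpose_mul_mul_eq_zero hH hE)⟩

end Data

/-! ### Perturbations of dual optimal points -/

section Perturbation

variable {n m : ℕ} {F : Matrix (Fin n ⊕ Fin m) (Fin n ⊕ Fin m) ℝ}

theorem continuous_toBlocks₂₂ {ι κ : Type*} :
    Continuous fun G : Matrix (ι ⊕ κ) (ι ⊕ κ) ℝ => G.toBlocks₂₂ := by
  simp only [toBlocks₂₂]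
  fun_prop

theorem eventually_isUnit_toBlocks₂₂ (hF : IsUnit F.toBlocks₂₂) :
    ∀ᶠ G in 𝓝 F, IsUnit G.toBlocks₂₂ := by
  simp only [isUnit_iff_isUnit_det, isUnit_iff_ne_zero] at hF ⊢
  exact continuous_toBlocks₂₂.matrix_det.continuousAt.eventually_ne hF

theorem continuousAt_gain (hF : IsUnit F.toBlocks₂₂) : ContinuousAt gain F := by
  have hdet : F.toBlocks₂₂.det ≠ 0 := ((isUnit_iff_isUnit_det _).1 hF).ne_zero
  have h₁₂ : Continuous fun G : Matrix (Fin n ⊕ Fin m) (Fin n ⊕ Fin m) ℝ => G.toBlocks₁₂ := by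
    simp only [toBlocks₁₂]
    fun_prop
  have hinv : ContinuousAt
      (fun G : Matrix (Fin n ⊕ Fin m) (Fin n ⊕ Fin m) ℝ => G.toBlocks₂₂⁻¹) F := by
    simp only [Matrix.inv_def, Ring.inverse_eq_inv']
    exact (continuous_toBlocks₂₂.matrix_det.continuousAt.inv₀ hdet).smul
      continuous_toBlocks₂₂.matrix_adjugate.continuousAt
  have hmul : Continuous fun p : Matrix (Fin m) (Fin m) ℝ × Matrix (Fin m) (Fin n) ℝ =>
      p.1 * p.2 := continuous_fst.matrix_mul continuous_snd
  exact (hmul.continuousAt.comp₂ hinv h₁₂.matrix_transpose.continuousAt).neg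

open scoped Matrix.Norms.Frobenius in
theorem exists_frobNorm_le_of_eventually {ι : Type*} [Fintype ι] {F : Matrix ι ι ℝ}
    {p : Matrix ι ι ℝ → Prop} (h : ∀ᶠ G in 𝓝 F, p G) :
    ∃ ε > 0, ∀ G, frobNorm (G - F) ≤ ε → p G := by
  obtain ⟨ε, hε, h⟩ := Metric.nhds_basis_closedBall.eventually_iff.1 h
  exact ⟨ε, hε, fun G hG => h (mem_closedBall_iff_norm.2 hG)⟩

end Perturbation

section Admissible

variable {n m : ℕ} {S : Data n m} {Ω : Type u} [MeasurableSpace Ω] {μ : Measure Ω}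
  [IsProbabilityMeasure μ] {x0 : Ω → Fin n → ℝ} {w : ℕ → Ω → Fin n → ℝ} {v : ℕ → Ω → ℝ}

theorem NoiseAssumption.posDef_secondMoment_add_smul (hn : NoiseAssumption μ x0 w v S.Sig S.σ) :
    (secondMoment μ x0 + (S.α / (1 - S.α)) • S.Sig).PosDef :=
  hn.posDef_secondMoment.add_posSemidef (hn.additive.cov_posDef.posSemidef.smul
    (div_nonneg S.α_pos.le (sub_nonneg.2 S.α_lt_one.le)))

namespace Data

theorem IsRiccatiSolution.powStable (hv : IsMultiplicativeNoise μ v S.σ)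
    (hdet : ExactlyDetectable.{u} S.A S.A₁ (psdSqrt S.Q) S.σ) {P : Matrix (Fin n) (Fin n) ℝ}
    (h : S.IsRiccatiSolution P) : PowStable (S.α • S.closedLoop (gain (S.H P))) :=
  powStable_of_exactlyDetectable hv hdet h.1 (h.eq_stageCost_add hv.variance_pos.le)

theorem DualOptimal.gain_eq_of_isOptimalGain (hn : NoiseAssumption μ x0 w v S.Sig S.σ)
    {F : Matrix (Fin n ⊕ Fin m) (Fin n ⊕ Fin m) ℝ} {M : Matrix (Fin n) (Fin n) ℝ}
    (hF : S.DualOptimal (secondMoment μ x0) F M) {L : Matrix (Fin m) (Fin n) ℝ}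
    (hL : S.IsOptimalGain μ x0 w v L) : gain F = L := by
  have hσ := hn.multiplicative.variance_pos.le
  obtain ⟨P, hP, rfl⟩ := hL.exists_isRiccatiSolution hn
  have hstable : PowStable (S.α • S.closedLoop (gain (S.H P))) :=
    ((admissible_iff_powStable hn).1 hL.1).smul (posMap_closedLoop hσ _) S.α_pos.le S.α_lt_one.le
  exact hF.gain_eq hσ hP hstable hn.posDef_secondMoment_add_smul

theorem eventually_admissible_gain (hn : NoiseAssumption μ x0 w v S.Sig S.σ)
    {F : Matrix (Fin n ⊕ Fin m) (Fin n ⊕ Fin m) ℝ} (hF : IsUnit F.toBlocks₂₂)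
    (h : Admissible.{u} S (gain F)) :
    ∀ᶠ G in 𝓝 F, IsUnit G.toBlocks₂₂ ∧ Admissible.{u} S (gain G) := by
  simp only [admissible_iff_powStable hn] at h ⊢
  exact (eventually_isUnit_toBlocks₂₂ hF).and ((continuousAt_gain hF).eventually
    (eventually_powStable_closedLoop hn.multiplicative.variance_pos.le h))

end Data

end Admissible

end StochLQR

theorem theorem5 {n m : ℕ} (S : StochLQR.Data n m)
    {Ω : Type u} [MeasurableSpace Ω] (P : Measure Ω) [IsProbabilityMeasure P]
    (x0 : Ω → Fin n → ℝ) (w : ℕ → Ω → Fin n → ℝ) (v : ℕ → Ω → ℝ)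
    (hnoise : StochLQR.NoiseAssumption P x0 w v S.Sig S.σ)
    (hstab : ∃ L : Matrix (Fin m) (Fin n) ℝ, StochLQR.Data.Admissible.{u} S L)
    (hdet : StochLQR.ExactlyDetectable.{u} S.A S.A₁ (StochLQR.psdSqrt S.Q) S.σ)
    (hopt : ∃ L : Matrix (Fin m) (Fin n) ℝ, S.IsOptimalGain P x0 w v L)
    (Pstar : Matrix (Fin n) (Fin n) ℝ) (hP : S.IsRiccatiSolution Pstar) :
    S.DualOptimal (StochLQR.secondMoment P x0) (S.H Pstar) Pstar ∧
    ∀ (Fstar : Matrix (Fin n ⊕ Fin m) (Fin n ⊕ Fin m) ℝ) (Mstar : Matrix (Fin n) (Fin n) ℝ),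
      S.DualOptimal (StochLQR.secondMoment P x0) Fstar Mstar →
      (∃ ε₀ : ℝ, 0 < ε₀ ∧ ∀ ε : ℝ, 0 < ε → ε ≤ ε₀ →
        ∀ Fhat : Matrix (Fin n ⊕ Fin m) (Fin n ⊕ Fin m) ℝ, Fhat.IsSymm →
          StochLQR.frobNorm (Fhat - Fstar) ≤ ε →
          IsUnit Fhat.toBlocks₂₂ ∧ StochLQR.Data.Admissible.{u} S (StochLQR.gain Fhat)) ∧
      (∀ (Fhat : ℕ → ℕ → Matrix (Fin n ⊕ Fin m) (Fin n ⊕ Fin m) ℝ) (ε : ℕ → ℕ → ℝ),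
        (∀ N K, (Fhat N K).IsSymm) →
        (∀ N K, StochLQR.frobNorm (Fhat N K - Fstar) ≤ ε N K) →
        Tendsto (fun p : ℕ × ℕ => ε p.1 p.2) (atTop ×ˢ atTop) (𝓝 0) →
        ∃ k₀ : ℕ, ∀ N K, k₀ ≤ N → k₀ ≤ K →
          IsUnit (Fhat N K).toBlocks₂₂ ∧
            StochLQR.Data.Admissible.{u} S (StochLQR.gain (Fhat N K))) := by
  obtain ⟨L, hL⟩ := hopt
  refine ⟨hP.dualOptimal hnoise.multiplicative.variance_pos.le (hP.powStable hnoise.multiplicative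
    hdet) hnoise.posDef_secondMoment_add_smul.posSemidef, fun Fstar Mstar hF => ?_⟩
  have hadm : StochLQR.Data.Admissible.{u} S (StochLQR.gain Fstar) := by
    rw [hF.gain_eq_of_isOptimalGain hnoise hL]
    exact hL.1
  obtain ⟨ε₀, hε₀, hball⟩ := StochLQR.exists_frobNorm_le_of_eventually
    (StochLQR.Data.eventually_admissible_gain hnoise hF.1.posDef.isUnit hadm)
  refine ⟨⟨ε₀, hε₀, fun ε _ hε G _ hG => hball G (hG.trans hε)⟩, fun G ε _ hG hlim => ?_⟩
  rw [prod_atTop_atTop_eq] at hlim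
  obtain ⟨⟨a, b⟩, hab⟩ := eventually_atTop.1 (hlim.eventually (gt_mem_nhds hε₀))
  refine ⟨max a b, fun N K hN hK => hball _ ((hG N K).trans (hab (N, K) ⟨?_, ?_⟩).le)⟩
  · exact (le_max_left a b).trans hN
  · exact (le_max_right a b).trans hK
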